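/- Let $D$ and $Y$ be (Hausdorff) complex manifolds of dimension $n$, and let $\pi:Y\to D$ be a holomorphic covering, i.e. a covering map that is locally biholomorphic. Suppose that $D$ admits a strictly plurisubharmonic function $\varphi:D\to\mathbb R$, that is, a function such that every point of $D$ has a coordinate neighbourhood with holomorphic coordinates $z=(z_1,\dots,z_n)$ on which $\varphi-\varepsilon|z|^2$ is (upper semicontinuous and) plurisubharmonic for some $\varepsilon>0$. Let $A\subset Y$ be an analytic subset, i.e. every point of $Y$ has an open neighbourhood in which $A$ is the common zero set of finitely many holomorphic functions, and suppose that $A$ has positive dimension, the dimension of $A$ being the supremum of its complex dimensions at its regular points. Then the projection $\pi(A)$ is not contained in any compact subset of $D$. -/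

import Mathlib

open scoped Manifold ContDiff Topology

noncomputable section

/-- A real-valued plurisubharmonic function on a set `V ⊆ ℂⁿ` (meant for open `V`): it is upper
semicontinuous on `V`, and for every closed complex disc `{a + ζ b : |ζ| ≤ 1}` contained in `V`
its value at the centre is at most its mean over the boundary circle. The mean is required to
exist as a finite real number, so that the inequality is never one with a junk value. -/
def IsPlurisubharmonicOn {n : ℕ} (u : EuclideanSpace ℂ (Fin n) → ℝ)
    (V : Set (EuclideanSpace ℂ (Fin n))) : Prop :=
  UpperSemicontinuousOn u V ∧
    ∀ a b : EuclideanSpace ℂ (Fin n), (∀ ζ : ℂ, ‖ζ‖ ≤ 1 → a + ζ • b ∈ V) →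
      CircleIntegrable (fun ζ : ℂ => u (a + ζ • b)) 0 1 ∧
        u a ≤ Real.circleAverage (fun ζ : ℂ => u (a + ζ • b)) 0 1

/-- A strictly plurisubharmonic function `φ : D → ℝ` on an `n`-dimensional complex manifold:
around every point there are holomorphic coordinates `z` and `ε > 0` such that `φ - ε |z|²` is
plurisubharmonic near that point. No smoothness of `φ` is required. -/
def IsStrictlyPlurisubharmonic (n : ℕ) {D : Type*} [TopologicalSpace D]
    [ChartedSpace (EuclideanSpace ℂ (Fin n)) D] (φ : D → ℝ) : Prop :=
  ∀ x : D, ∃ e ∈ IsManifold.maximalAtlas 𝓘(ℂ, EuclideanSpace ℂ (Fin n)) ω D, x ∈ e.source ∧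
    ∃ V : Set (EuclideanSpace ℂ (Fin n)), IsOpen V ∧ e x ∈ V ∧ V ⊆ e.target ∧
      ∃ ε : ℝ, 0 < ε ∧ IsPlurisubharmonicOn (fun z => φ (e.symm z) - ε * ‖z‖ ^ 2) V

/-- An analytic subset `A` of an `n`-dimensional complex manifold `Y`: every point of `Y` (not only
of `A`) has an open neighbourhood in which `A` is the common zero set of finitely many holomorphic
functions. In particular `A` is closed. -/
def IsAnalyticSubset (n : ℕ) {Y : Type*} [TopologicalSpace Y]
    [ChartedSpace (EuclideanSpace ℂ (Fin n)) Y] (A : Set Y) : Prop :=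
  ∀ y : Y, ∃ U : Set Y, IsOpen U ∧ y ∈ U ∧ ∃ (m : ℕ) (f : Fin m → Y → ℂ),
    (∀ i, ContMDiffOn 𝓘(ℂ, EuclideanSpace ℂ (Fin n)) 𝓘(ℂ) ω (f i) U) ∧
      ∀ z ∈ U, z ∈ A ↔ ∀ i, f i z = 0

/-- `y` is a regular point of `A` of dimension `k`: `y ∈ A`, and near `y` the set `A` is a
`k`-dimensional complex submanifold, i.e. in suitable holomorphic coordinates around `y` it is a
`k`-dimensional complex linear subspace. -/
def IsRegularPointOfDim (n : ℕ) {Y : Type*} [TopologicalSpace Y]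
    [ChartedSpace (EuclideanSpace ℂ (Fin n)) Y] (A : Set Y) (k : ℕ) (y : Y) : Prop :=
  y ∈ A ∧ ∃ e ∈ IsManifold.maximalAtlas 𝓘(ℂ, EuclideanSpace ℂ (Fin n)) ω Y, y ∈ e.source ∧
    ∃ S : Submodule ℂ (EuclideanSpace ℂ (Fin n)), Module.finrank ℂ S = k ∧
      ∀ z ∈ e.source, z ∈ A ↔ e z ∈ S

/-- The complex dimension of an analytic subset: the supremum of its dimensions at its regular
points (`⊥` for the empty set). -/
def analyticDim (n : ℕ) {Y : Type*} [TopologicalSpace Y]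
    [ChartedSpace (EuclideanSpace ℂ (Fin n)) Y] (A : Set Y) : WithBot ℕ∞ :=
  ⨆ (k : ℕ) (_ : ∃ y : Y, IsRegularPointOfDim n A k y), (k : WithBot ℕ∞)

/-- A holomorphic covering of complex manifolds: a covering map that is locally biholomorphic. -/
def IsHolomorphicCovering (n : ℕ) {Y D : Type*} [TopologicalSpace Y] [TopologicalSpace D]
    [ChartedSpace (EuclideanSpace ℂ (Fin n)) Y] [ChartedSpace (EuclideanSpace ℂ (Fin n)) D]
    (π : Y → D) : Prop :=
  IsCoveringMap π ∧
    IsLocalDiffeomorph 𝓘(ℂ, EuclideanSpace ℂ (Fin n)) 𝓘(ℂ, EuclideanSpace ℂ (Fin n)) ω π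

end

open Filter Metric Set

/-! ### Means over circles of square norms and of `log ‖g‖`. -/

section CircleAverages

open Real

variable {H : Type*} [NormedAddCommGroup H] [InnerProductSpace ℂ H]

/-! Suppose `π '' A ⊆ K` with `K` compact. Points through which `A` contains an embedded disc
(`HasLocalDisc`) exist because the dimension is positive, and `φ ∘ π` is bounded above on them
because `φ` is upper semicontinuous. Let M be the supremum. It need not be attained, so attainment
is replaced by a gap: near each point of `D` there is η > 0 such that `φ ∘ π ≤ M - η` at all such
points lying above (`IsHolomorphicCovering.exists_eventually_le_sub`). Compactness of `K` makes η
uniform, and M ≤ M - η is absurd.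

The gap comes from strictness. On each sheet over an evenly covered coordinate ball of radius r
about a, the function φ - (ε/2)|z - a|² still obeys a maximum principle along `A`, so it is at most
M - (ε/2)r². This bound does not depend on the sheet.

The maximum principle (`IsPlurisubharmonicOn.le_of_hasLocalDisc`) has to cope with singularities of
`A`, and does so without stratification. For a disc germ c in `A`, let I be the set of analytic
functions vanishing on c; its zero set lies in `A`. For suitable functions F, the operator that
replaces the j-th of them by h and takes the Jacobian determinant maps I to itself. Where g =
`jacobianDet F` is nonzero this operator is g times a derivation, whose integral curves are discs in
the zero set of I. Adding δ log|g| keeps a maximum away from g = 0, and a maximum elsewhere is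
excluded by `IsPlurisubharmonicOn.not_isLocalMax_along_disc`. That lemma uses means over affine
circles only: the disc is replaced by a large penalty on the distance from it. -/

theorem circleAverage_re_eq {f : ℂ → ℂ} (hf : DiffContOnCl ℂ f (ball 0 1)) :
    circleAverage (fun ζ => (f ζ).re) 0 1 = (f 0).re := by
  have hci : CircleIntegrable f 0 1 := by
    refine ContinuousOn.circleIntegrable zero_le_one (hf.continuousOn_ball.mono ?_)
    exact sphere_subset_closedBall
  have h := Complex.reCLM.circleAverage_comp_comm hci
  have h2 : circleAverage f 0 1 = f 0 :=
    DiffContOnCl.circleAverage (by simpa using hf)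
  rw [h2] at h
  exact h

/-- The cross term 2 Re⟨a, f⟩ is harmonic and vanishes at the centre, so its mean is zero. Hence a
penalty `‖t‖²` can be flat to second order even at points where `t ≠ 0`. -/
theorem circleAverage_norm_add_sq {f : ℂ → H} {a : H} (hf : DiffContOnCl ℂ f (ball 0 1))
    (hf0 : f 0 = 0) :
    circleAverage (fun ζ => ‖a + f ζ‖ ^ 2) 0 1 =
      ‖a‖ ^ 2 + circleAverage (fun ζ => ‖f ζ‖ ^ 2) 0 1 := by
  have hc : ContinuousOn f (sphere 0 1) := hf.continuousOn_ball.mono sphere_subset_closedBall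
  have hin : DiffContOnCl ℂ (fun ζ => inner ℂ a (f ζ)) (ball 0 1) :=
    ((innerSL ℂ a).differentiable.diffContOnCl (s := univ)).comp hf (mapsTo_univ _ _)
  have hre := circleAverage_re_eq hin
  simp only [hf0, inner_zero_right, Complex.zero_re] at hre
  have hc2 : ContinuousOn (fun ζ => (inner ℂ a (f ζ)).re) (sphere 0 1) :=
    Complex.continuous_re.comp_continuousOn (hin.continuousOn_ball.mono sphere_subset_closedBall)
  have i1 : CircleIntegrable (fun ζ => ‖a‖ ^ 2 + 2 * (inner ℂ a (f ζ)).re) 0 1 :=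
    ContinuousOn.circleIntegrable zero_le_one (by fun_prop)
  have i2 : CircleIntegrable (fun ζ => ‖f ζ‖ ^ 2) 0 1 :=
    ContinuousOn.circleIntegrable zero_le_one (by fun_prop)
  have i3 : CircleIntegrable (fun ζ => 2 * (inner ℂ a (f ζ)).re) 0 1 :=
    ContinuousOn.circleIntegrable zero_le_one (by fun_prop)
  have hexp : (fun ζ => ‖a + f ζ‖ ^ 2) =
      fun ζ => (‖a‖ ^ 2 + 2 * (inner ℂ a (f ζ)).re) + ‖f ζ‖ ^ 2 := by
    ext ζ
    exact norm_add_sq (𝕜 := ℂ) a (f ζ)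
  rw [hexp, circleAverage_fun_add i1 i2, circleAverage_fun_add (circleIntegrable_const _ _ _) i3,
    circleAverage_const]
  have := circleAverage_fun_smul (f := fun ζ => (inner ℂ a (f ζ)).re) (a := (2 : ℝ)) (c := 0)
    (R := 1)
  simp only [smul_eq_mul] at this
  rw [this, hre]
  ring

/-- `Q` is continuous and its mean over each circle of centre `p` and direction `b` exceeds its
value at `p` by exactly `κ ‖b‖²`. -/
def CircleGrowth (Q : H → ℝ) (κ : ℝ) : Prop :=
  Continuous Q ∧ ∀ p b : H, circleAverage (fun ζ : ℂ => Q (p + ζ • b)) 0 1 = Q p + κ * ‖b‖ ^ 2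

theorem circleGrowth_norm_sub_sq (a : H) : CircleGrowth (fun q => ‖q - a‖ ^ 2) 1 := by
  refine ⟨by fun_prop, fun p b => ?_⟩
  have h := circleAverage_norm_add_sq (f := fun ζ : ℂ => ζ • b) (a := p - a)
    (Differentiable.diffContOnCl (by fun_prop)) (by simp)
  have h2 : circleAverage (fun ζ : ℂ => ‖ζ • b‖ ^ 2) 0 1 = ‖b‖ ^ 2 := by
    refine circleAverage_const_on_circle fun ζ hζ => ?_
    rw [norm_smul, show ‖ζ‖ = 1 by simpa using hζ, one_mul]
  rw [h2] at h
  simp only [one_mul]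
  rw [← h]
  congr 1
  ext ζ
  congr 2
  abel

theorem CircleGrowth.sub {Q R : H → ℝ} {κ μ : ℝ} (hQ : CircleGrowth Q κ)
    (hR : CircleGrowth R μ) : CircleGrowth (fun q => Q q - R q) (κ - μ) := by
  refine ⟨hQ.1.sub hR.1, fun p b => ?_⟩
  have h1 : CircleIntegrable (fun ζ : ℂ => Q (p + ζ • b)) 0 1 :=
    (hQ.1.comp (by fun_prop)).continuousOn.circleIntegrable zero_le_one
  have h2 : CircleIntegrable (fun ζ : ℂ => R (p + ζ • b)) 0 1 :=
    (hR.1.comp (by fun_prop)).continuousOn.circleIntegrable zero_le_one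
  rw [circleAverage_fun_sub h1 h2, hQ.2, hR.2]
  ring

theorem CircleGrowth.const_mul {Q : H → ℝ} {κ : ℝ} (hQ : CircleGrowth Q κ) (c : ℝ) :
    CircleGrowth (fun q => c * Q q) (c * κ) := by
  refine ⟨by have := hQ.1; fun_prop, fun p b => ?_⟩
  have := circleAverage_fun_smul (f := fun ζ : ℂ => Q (p + ζ • b)) (a := c) (c := 0) (R := 1)
  simp only [smul_eq_mul] at this
  rw [this, hQ.2]
  ring

/-- A holomorphic map whose derivative in the direction `b` vanishes at `p` has square norm whose
circle means grow at most like the fourth power of the radius. -/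
theorem exists_circleAverage_norm_sq_le [CompleteSpace H] {E : Type*} [NormedAddCommGroup E]
    [NormedSpace ℂ E] {t : E → H} {p b : E} (ht : AnalyticAt ℂ t p) (hb : fderiv ℂ t p b = 0) :
    ∃ C : ℝ, ∀ᶠ r : ℝ in 𝓝[>] 0,
      ContinuousOn (fun ζ : ℂ => t (p + ζ • (r • b))) (sphere 0 1) ∧
      circleAverage (fun ζ : ℂ => ‖t (p + ζ • (r • b))‖ ^ 2) 0 1 ≤ ‖t p‖ ^ 2 + C * r ^ 4 := by
  have hline : AnalyticAt ℂ (fun ζ : ℂ => p + ζ • b) 0 := by fun_prop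
  set h : ℂ → H := fun ζ => t (p + ζ • b) with hh
  have hha : AnalyticAt ℂ h 0 := by
    refine AnalyticAt.fun_comp (g := t) (f := fun ζ : ℂ => p + ζ • b) (by simpa using ht) hline
  have hd : deriv h 0 = 0 := by
    have h1 : HasDerivAt (fun ζ : ℂ => p + ζ • b) b 0 := by
      simpa using ((hasDerivAt_id (0 : ℂ)).smul_const b).const_add p
    have h2 : HasFDerivAt t (fderiv ℂ t p) (p + (0 : ℂ) • b) := by
      simpa using ht.differentiableAt.hasFDerivAt
    have := h2.comp_hasDerivAt (0 : ℂ) h1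
    rw [hb] at this
    exact this.deriv
  have h0 : h 0 = t p := by simp [hh]
  have hO : (fun ζ => h ζ - h 0) =O[𝓝 0] fun ζ : ℂ => ‖ζ‖ ^ 2 := by
    have hord : ((2 : ℕ) : ℕ∞) ≤ analyticOrderAt (fun ζ => h ζ - h 0) 0 := by
      have h3 := hha.analyticOrderAt_deriv_add_one
      rw [← h3]
      have : 1 ≤ analyticOrderAt (deriv h) 0 := by
        rw [Order.one_le_iff_ne_zero]
        intro h4
        exact (hha.deriv.analyticOrderAt_eq_zero.mp h4) hd
      calc ((2 : ℕ) : ℕ∞) = 1 + 1 := by norm_num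
        _ ≤ _ := by gcongr
    obtain ⟨g, hg, hge⟩ := (natCast_le_analyticOrderAt (by fun_prop)).mp hord
    have hgO : g =O[𝓝 0] fun _ : ℂ => (1 : ℂ) := hg.continuousAt.isBigO_one ℂ
    have : (fun ζ => h ζ - h 0) =ᶠ[𝓝 0] fun ζ => (ζ ^ 2) • g ζ := by
      filter_upwards [hge] with ζ hζ
      simpa using hζ
    refine this.trans_isBigO ?_
    have := (Asymptotics.isBigO_refl (fun ζ : ℂ => ζ ^ 2) (𝓝 0)).smul hgO
    refine this.trans (Asymptotics.isBigO_of_le _ fun ζ => ?_)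
    simp
  obtain ⟨C, hC⟩ := hO.bound
  obtain ⟨ρ, hρ, hball⟩ := Metric.eventually_nhds_iff_ball.mp
    (hC.and (hha.eventually_analyticAt))
  refine ⟨C ^ 2, ?_⟩
  have hr : ∀ᶠ r : ℝ in 𝓝[>] 0, 0 < r ∧ r < ρ :=
    (eventually_mem_nhdsWithin).and (mem_nhdsWithin_of_mem_nhds (Iio_mem_nhds hρ))
  filter_upwards [hr] with r ⟨hr0, hr⟩
  have hmem : ∀ ζ ∈ closedBall (0 : ℂ) 1, (r : ℂ) * ζ ∈ ball (0 : ℂ) ρ := by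
    intro ζ hζ
    rw [mem_closedBall_zero_iff] at hζ
    rw [mem_ball_zero_iff, norm_mul, Complex.norm_real, Real.norm_of_nonneg hr0.le]
    nlinarith
  have heq : (fun ζ : ℂ => t (p + ζ • (r • b))) = fun ζ => h (r * ζ) := by
    ext ζ
    simp only [hh]
    rw [mul_comm, mul_smul, Complex.coe_smul]
  have hdiff : ∀ ζ ∈ closedBall (0 : ℂ) 1, DifferentiableAt ℂ (fun ζ : ℂ => h (r * ζ)) ζ := by
    intro ζ hζ
    exact (hball _ (hmem ζ hζ)).2.differentiableAt.comp ζ (by fun_prop)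
  have hdc : DiffContOnCl ℂ (fun ζ : ℂ => h (r * ζ)) (ball 0 1) := by
    refine DifferentiableOn.diffContOnCl fun ζ hζ => ?_
    rw [closure_ball _ one_ne_zero] at hζ
    exact (hdiff ζ hζ).differentiableWithinAt
  have hcont : ContinuousOn (fun ζ : ℂ => h (r * ζ)) (sphere 0 1) :=
    hdc.continuousOn_ball.mono sphere_subset_closedBall
  have heq2 : (fun ζ : ℂ => ‖t (p + ζ • (r • b))‖ ^ 2) = fun ζ => ‖h (r * ζ)‖ ^ 2 := by
    ext ζ
    rw [show t (p + ζ • (r • b)) = h (r * ζ) from congrFun heq ζ]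
  rw [heq, heq2]
  refine ⟨hcont, ?_⟩
  have hav := circleAverage_norm_add_sq (f := fun ζ => h (r * ζ) - h 0) (a := h 0)
    (hdc.sub diffContOnCl_const) (by simp)
  simp only [add_sub_cancel] at hav
  rw [hav, h0]
  gcongr
  refine circleAverage_mono_on_of_le_circle
    (ContinuousOn.circleIntegrable zero_le_one
      ((hcont.sub continuousOn_const).norm.pow 2)) fun ζ hζ => ?_
  have hζ1 : ‖ζ‖ = 1 := by simpa using hζ
  have hb1 := (hball _ (hmem ζ (by simp [hζ1]))).1
  have : ‖h (r * ζ) - t p‖ ≤ C * r ^ 2 := by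
    rw [← h0]
    simpa [hζ1] using hb1
  calc ‖h (r * ζ) - t p‖ ^ 2 ≤ (C * r ^ 2) ^ 2 := by gcongr
    _ = C ^ 2 * r ^ 4 := by ring

/-- Off the zeros of `g` the barrier `δ log ‖g‖` is pluriharmonic, so it contributes nothing to the
comparison of means. -/
theorem eventually_circleAverage_log_norm {E : Type*} [NormedAddCommGroup E]
    [NormedSpace ℂ E] {g : E → ℂ} {p : E} (b : E) (hg : AnalyticAt ℂ g p) (hgp : g p ≠ 0) :
    ∀ᶠ r : ℝ in 𝓝[>] 0,
      CircleIntegrable (fun ζ : ℂ => log ‖g (p + ζ • (r • b))‖) 0 1 ∧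
      circleAverage (fun ζ : ℂ => log ‖g (p + ζ • (r • b))‖) 0 1 = log ‖g p‖ := by
  set h : ℂ → ℂ := fun ζ => g (p + ζ • b) with hh
  have hha : AnalyticAt ℂ h 0 := by
    refine AnalyticAt.fun_comp (g := g) (f := fun ζ : ℂ => p + ζ • b) (by simpa using hg)
      (by fun_prop)
  have h0 : h 0 = g p := by simp [hh]
  obtain ⟨ρ, hρ, hball⟩ := Metric.eventually_nhds_iff_ball.mp
    ((hha.continuousAt.eventually_ne (h0 ▸ hgp)).and (hha.eventually_analyticAt))
  have hr : ∀ᶠ r : ℝ in 𝓝[>] 0, 0 < r ∧ r < ρ :=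
    (eventually_mem_nhdsWithin).and (mem_nhdsWithin_of_mem_nhds (Iio_mem_nhds hρ))
  filter_upwards [hr] with r ⟨hr0, hr⟩
  have hmem : ∀ ζ ∈ closedBall (0 : ℂ) 1, (r : ℂ) * ζ ∈ ball (0 : ℂ) ρ := by
    intro ζ hζ
    rw [mem_closedBall_zero_iff] at hζ
    rw [mem_ball_zero_iff, norm_mul, Complex.norm_real, Real.norm_of_nonneg hr0.le]
    nlinarith
  have heq : (fun ζ : ℂ => log ‖g (p + ζ • (r • b))‖) = fun ζ => log ‖h (r * ζ)‖ := by
    ext ζ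
    simp only [hh]
    rw [mul_comm, mul_smul, Complex.coe_smul]
  have han : AnalyticOnNhd ℂ (fun ζ : ℂ => h (r * ζ)) (closedBall 0 |1|) := by
    intro ζ hζ
    rw [abs_one] at hζ
    exact AnalyticAt.fun_comp (g := h) (hball _ (hmem ζ hζ)).2 (by fun_prop)
  have hne : ∀ ζ ∈ closedBall (0 : ℂ) |1|, h (r * ζ) ≠ 0 := by
    intro ζ hζ
    rw [abs_one] at hζ
    exact (hball _ (hmem ζ hζ)).1
  rw [heq]
  constructor
  · refine ContinuousOn.circleIntegrable zero_le_one fun ζ hζ => ?_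
    have hζ' : ζ ∈ closedBall (0 : ℂ) |1| := by
      rw [abs_one]; exact sphere_subset_closedBall hζ
    exact ((han ζ hζ').continuousAt.norm.log
      (norm_ne_zero_iff.mpr (hne ζ hζ'))).continuousWithinAt
  · rw [AnalyticOnNhd.circleAverage_log_norm_of_ne_zero han hne]
    simp [h0]

end CircleAverages

/-- A substitute for attaining a maximum: local gaps become one uniform gap by taking the least over
a finite subcover. -/
theorem IsCompact.exists_pos_forall {X : Type*} [TopologicalSpace X] {K : Set X}
    (hK : IsCompact K) {P : X → ℝ → Prop}
    (hmono : ∀ x η η', 0 < η' → η' ≤ η → P x η → P x η')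
    (h : ∀ p ∈ K, ∃ η > 0, ∀ᶠ q in 𝓝 p, P q η) : ∃ η > 0, ∀ q ∈ K, P q η := by
  refine hK.induction_on (p := fun S => ∃ η > 0, ∀ q ∈ S, P q η) ⟨1, one_pos, by simp⟩ ?_ ?_ ?_
  · rintro s t hst ⟨η, hη, h⟩
    exact ⟨η, hη, fun q hq => h q (hst hq)⟩
  · rintro s t ⟨η, hη, h⟩ ⟨η', hη', h'⟩
    refine ⟨min η η', lt_min hη hη', ?_⟩
    rintro q (hq | hq)
    · exact hmono q η _ (lt_min hη hη') (min_le_left _ _) (h q hq)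
    · exact hmono q η' _ (lt_min hη hη') (min_le_right _ _) (h' q hq)
  · intro p hp
    obtain ⟨η, hη, hq⟩ := h p hp
    exact ⟨{q | P q η}, mem_nhdsWithin_of_mem_nhds hq, η, hη, fun q hq => hq⟩

/-! ### Maximum principle along an embedded disc. -/

section MaximumPrinciple

open Real

variable {n : ℕ}

theorem IsPlurisubharmonicOn.upperSemicontinuousAt {w : EuclideanSpace ℂ (Fin n) → ℝ}
    {V : Set (EuclideanSpace ℂ (Fin n))} (hw : IsPlurisubharmonicOn w V) (hV : IsOpen V)
    {z : EuclideanSpace ℂ (Fin n)} (hz : z ∈ V) : UpperSemicontinuousAt w z := by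
  intro y hy
  have := hw.1 z hz y hy
  rwa [hV.nhdsWithin_eq hz] at this

theorem IsPlurisubharmonicOn.mono {w : EuclideanSpace ℂ (Fin n) → ℝ}
    {V W : Set (EuclideanSpace ℂ (Fin n))} (hw : IsPlurisubharmonicOn w V) (h : W ⊆ V) :
    IsPlurisubharmonicOn w W :=
  ⟨hw.1.mono h, fun a b hab => hw.2 a b fun ζ hζ => h (hab ζ hζ)⟩

/-- A strictly plurisubharmonic function, corrected by a pluriharmonic term and by a penalty
`N ‖t‖²` that is flat to second order at `p` in some direction `b`, has no local maximum at `p`. -/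
theorem IsPlurisubharmonicOn.not_isLocalMax_sub_norm_sq
    {w : EuclideanSpace ℂ (Fin n) → ℝ} {V : Set (EuclideanSpace ℂ (Fin n))}
    (hw : IsPlurisubharmonicOn w V) (hV : IsOpen V) {p b : EuclideanSpace ℂ (Fin n)} (hp : p ∈ V)
    (hb : b ≠ 0) {Q : EuclideanSpace ℂ (Fin n) → ℝ} {κ : ℝ} (hQ : CircleGrowth Q κ) (hκ : 0 < κ)
    {g : EuclideanSpace ℂ (Fin n) → ℂ} (hg : AnalyticAt ℂ g p) (hgp : g p ≠ 0) (δ : ℝ)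
    {t : EuclideanSpace ℂ (Fin n) → EuclideanSpace ℂ (Fin n)} (ht : AnalyticAt ℂ t p)
    (htb : fderiv ℂ t p b = 0) {N : ℝ} (hN : 0 ≤ N) :
    ¬ IsLocalMax (fun q => w q + Q q + δ * log ‖g q‖ - N * ‖t q‖ ^ 2) p := by
  intro hmax
  obtain ⟨C, hC⟩ := exists_circleAverage_norm_sq_le ht htb
  have hlog := eventually_circleAverage_log_norm b hg hgp
  obtain ⟨R, hR, hball⟩ := Metric.eventually_nhds_iff_ball.mp (hmax.and (hV.mem_nhds hp))
  have hb' : 0 < ‖b‖ := norm_pos_iff.mpr hb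
  have hr : ∀ᶠ r : ℝ in 𝓝[>] 0, 0 < r ∧ r < R / ‖b‖ :=
    (eventually_mem_nhdsWithin).and (mem_nhdsWithin_of_mem_nhds (Iio_mem_nhds (by positivity)))
  -- On the circle of radius r, `Q` gains `κ ‖b‖² r²` while the penalty gains at most `N C r⁴`.
  -- Dividing by r² and letting r tend to 0 contradicts `κ > 0`.
  have key : ∀ᶠ r : ℝ in 𝓝[>] 0, κ * ‖b‖ ^ 2 ≤ N * C * r ^ 2 := by
    filter_upwards [hC, hlog, hr] with r ⟨htc, htC⟩ ⟨hgi, hga⟩ ⟨hr0, hrR⟩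
    have hmem : ∀ ζ : ℂ, ‖ζ‖ ≤ 1 → p + ζ • (r • b) ∈ ball p R := by
      intro ζ hζ
      rw [mem_ball_iff_norm, add_sub_cancel_left, norm_smul, norm_smul, Real.norm_of_nonneg hr0.le]
      rw [lt_div_iff₀ hb'] at hrR
      nlinarith [norm_nonneg ζ, mul_pos hr0 hb']
    obtain ⟨hwi, hwa⟩ := hw.2 p (r • b) fun ζ hζ => (hball _ (hmem ζ hζ)).2
    set c0 := w p + Q p + δ * log ‖g p‖ - N * ‖t p‖ ^ 2
    have hQi : CircleIntegrable (fun ζ : ℂ => Q (p + ζ • (r • b))) 0 1 :=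
      (hQ.1.comp (by fun_prop)).continuousOn.circleIntegrable zero_le_one
    have hti : CircleIntegrable (fun ζ : ℂ => ‖t (p + ζ • (r • b))‖ ^ 2) 0 1 :=
      (htc.norm.pow 2).circleIntegrable zero_le_one
    have hgi' := hgi.const_smul (a := δ)
    have hti' := hti.const_smul (a := N)
    have hcQ := (circleIntegrable_const c0 0 1).sub hQi
    have hle : w p ≤ circleAverage ((((fun _ => c0) - fun ζ : ℂ => Q (p + ζ • (r • b)))
        - δ • fun ζ : ℂ => log ‖g (p + ζ • (r • b))‖)
        + N • fun ζ : ℂ => ‖t (p + ζ • (r • b))‖ ^ 2) 0 1 := by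
      refine hwa.trans (circleAverage_mono hwi ((hcQ.sub hgi').add hti') fun ζ hζ => ?_)
      have := (hball _ (hmem ζ (by simp_all))).1
      simp only [Pi.add_apply, Pi.sub_apply, Pi.smul_apply, smul_eq_mul]
      linarith
    rw [circleAverage_add (hcQ.sub hgi') hti', circleAverage_sub hcQ hgi',
      circleAverage_sub (circleIntegrable_const c0 0 1) hQi, circleAverage_const,
      circleAverage_smul, circleAverage_smul, hQ.2, hga] at hle
    simp only [smul_eq_mul, norm_smul, Real.norm_of_nonneg hr0.le] at hle
    have h2 := mul_le_mul_of_nonneg_left htC hN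
    have h3 : κ * ‖b‖ ^ 2 * r ^ 2 ≤ N * C * r ^ 2 * r ^ 2 := by
      simp only [c0] at hle
      nlinarith
    exact le_of_mul_le_mul_right h3 (by positivity)
  have hlim : Tendsto (fun r : ℝ => N * C * r ^ 2) (𝓝[>] 0) (𝓝 0) := by
    have : Tendsto (fun r : ℝ => N * C * r ^ 2) (𝓝 0) (𝓝 (N * C * 0 ^ 2)) :=
      Continuous.tendsto (by fun_prop) 0
    simp only [ne_eq, OfNat.ofNat_ne_zero, not_false_eq_true, zero_pow, mul_zero] at this
    exact this.mono_left nhdsWithin_le_nhds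
  have := ge_of_tendsto hlim key
  have : 0 < κ * ‖b‖ ^ 2 := by positivity
  linarith

/-- The maximum principle for strictly plurisubharmonic functions along an embedded disc, here
`ζ ↦ G (F z + ζ • v)` in the local coordinates `F` with inverse `G`. -/
theorem IsPlurisubharmonicOn.not_isLocalMax_along_disc
    {w : EuclideanSpace ℂ (Fin n) → ℝ} {V : Set (EuclideanSpace ℂ (Fin n))}
    (hw : IsPlurisubharmonicOn w V) (hV : IsOpen V) {z : EuclideanSpace ℂ (Fin n)} (hz : z ∈ V)
    {Q : EuclideanSpace ℂ (Fin n) → ℝ} {κ : ℝ} (hQ : CircleGrowth Q κ) (hκ : 0 < κ)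
    {g : EuclideanSpace ℂ (Fin n) → ℂ} (hg : AnalyticAt ℂ g z) (hgz : g z ≠ 0) (δ : ℝ)
    {F G : EuclideanSpace ℂ (Fin n) → EuclideanSpace ℂ (Fin n)} {v : EuclideanSpace ℂ (Fin n)}
    (hF : AnalyticAt ℂ F z) (hG : AnalyticAt ℂ G (F z)) (hGF : ∀ᶠ q in 𝓝 z, G (F q) = q)
    (hFG : ∀ᶠ x in 𝓝 (F z), F (G x) = x) (hv : v ≠ 0) :
    ¬ ∀ᶠ ζ : ℂ in 𝓝 0, w (G (F z + ζ • v)) + Q (G (F z + ζ • v)) + δ * log ‖g (G (F z + ζ • v))‖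
      ≤ w z + Q z + δ * log ‖g z‖ := by
  intro hmax
  set Ψ : EuclideanSpace ℂ (Fin n) → ℝ := fun q => w q + Q q + δ * log ‖g q‖ with hΨ
  have hv2 : (inner ℂ v v : ℂ) ≠ 0 := by simpa using hv
  set coord : EuclideanSpace ℂ (Fin n) →L[ℂ] ℂ := (inner ℂ v v : ℂ)⁻¹ • innerSL ℂ v with hcoord
  have hcv : coord v = 1 := by simp only [hcoord]; simpa using inv_mul_cancel₀ hv2
  -- The transverse coordinate: near `z` it vanishes exactly on the disc.
  set t : EuclideanSpace ℂ (Fin n) → EuclideanSpace ℂ (Fin n) :=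
    fun q => (F q - F z) - coord (F q - F z) • v with ht
  have hta : ∀ p, AnalyticAt ℂ F p → AnalyticAt ℂ t p := by
    intro p hp
    have h1 : AnalyticAt ℂ (fun q => F q - F z) p := hp.sub analyticAt_const
    exact h1.sub (((coord.analyticAt _).fun_comp h1).smul analyticAt_const)
  have htz : t z = 0 := by simp [ht]
  have hgood : ∀ᶠ p in 𝓝 z, (p ∈ V ∧ AnalyticAt ℂ g p ∧ g p ≠ 0 ∧ AnalyticAt ℂ F p) ∧
      (AnalyticAt ℂ G (F p) ∧ G (F p) = p ∧ ∀ᶠ x in 𝓝 (F p), F (G x) = x) ∧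
      (t p = 0 → Ψ p ≤ Ψ z) := by
    have hFt : Tendsto F (𝓝 z) (𝓝 (F z)) := hF.continuousAt
    have hζ : Tendsto (fun q => coord (F q - F z)) (𝓝 z) (𝓝 0) := by
      have : ContinuousAt (fun q => coord (F q - F z)) z :=
        coord.continuous.continuousAt.comp (hF.continuousAt.sub continuousAt_const)
      simpa [ContinuousAt] using this
    filter_upwards [hV.mem_nhds hz, hg.eventually_analyticAt, hg.continuousAt.eventually_ne hgz,
      hF.eventually_analyticAt, hFt.eventually hG.eventually_analyticAt, hGF,
      hFt.eventually hFG.eventually_nhds, hζ.eventually hmax] with p h1 h2 h3 h4 h5 h6 h7 h8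
    refine ⟨⟨h1, h2, h3, h4⟩, ⟨h5, h6, h7⟩, fun htp => ?_⟩
    have : F z + coord (F p - F z) • v = F p := by
      rw [← sub_eq_zero.mp htp]; abel
    rw [this, h6] at h8
    exact h8
  obtain ⟨ρ, hρ, hball⟩ := nhds_basis_closedBall.mem_iff.mp hgood
  -- Half of the growth is spent on a strict drop at the sphere; the other half remains for the
  -- contradiction at `p`.
  set Q' : EuclideanSpace ℂ (Fin n) → ℝ := fun q => Q q - κ / 2 * ‖q - z‖ ^ 2 with hQ'
  have hQ'g : CircleGrowth Q' (κ - κ / 2 * 1) :=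
    hQ.sub ((circleGrowth_norm_sub_sq z).const_mul (κ / 2))
  have husc : ∀ N : ℝ, ∀ p ∈ closedBall z ρ,
      UpperSemicontinuousAt (fun q => w q + Q' q + δ * log ‖g q‖ - N * ‖t q‖ ^ 2) p := by
    intro N p hp
    obtain ⟨⟨h1, h2, h3, h4⟩, -, -⟩ := hball hp
    have hc : ContinuousAt (fun q => Q' q + δ * log ‖g q‖ - N * ‖t q‖ ^ 2) p := by
      have a1 : ContinuousAt Q' p := hQ'g.1.continuousAt
      have a2 : ContinuousAt (fun q => log ‖g q‖) p :=
        h2.continuousAt.norm.log (norm_ne_zero_iff.mpr h3)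
      have a3 : ContinuousAt (fun q => ‖t q‖ ^ 2) p := (hta p h4).continuousAt.norm.pow 2
      exact (a1.add (a2.const_mul δ)).sub (a3.const_mul N)
    have := (hw.upperSemicontinuousAt hV h1).add hc.upperSemicontinuousAt
    have heq : (fun q => w q + Q' q + δ * log ‖g q‖ - N * ‖t q‖ ^ 2) =
        fun q => w q + (Q' q + δ * log ‖g q‖ - N * ‖t q‖ ^ 2) := funext fun q => by ring
    rwa [heq]
  obtain ⟨η, hη, hsphere⟩ := (isCompact_sphere z ρ).exists_pos_forall
    (P := fun q η => w q + Q' q + δ * log ‖g q‖ - η⁻¹ * ‖t q‖ ^ 2 < Ψ z)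
    (by
      intro q η η' hη' hle h
      have : η⁻¹ * ‖t q‖ ^ 2 ≤ η'⁻¹ * ‖t q‖ ^ 2 := by gcongr
      linarith)
    (by
      intro p hp
      have hpc := sphere_subset_closedBall hp
      suffices h : ∃ η > 0, w p + Q' p + δ * log ‖g p‖ - η⁻¹ * ‖t p‖ ^ 2 < Ψ z by
        obtain ⟨η, hη, h⟩ := h
        exact ⟨η, hη, husc _ p hpc _ h⟩
      have hΨp : w p + Q' p + δ * log ‖g p‖ = Ψ p - κ / 2 * ρ ^ 2 := by
        rw [mem_sphere_iff_norm] at hp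
        simp only [hΨ, hQ', hp]
        ring
      have hpos : 0 < κ / 2 * ρ ^ 2 := by positivity
      by_cases htp : t p = 0
      · refine ⟨1, one_pos, ?_⟩
        have := (hball hpc).2.2 htp
        rw [hΨp, htp]
        simp only [norm_zero]
        linarith
      · have htpos : 0 < ‖t p‖ ^ 2 := by have := norm_pos_iff.mpr htp; positivity
        -- This choice makes the penalty `η⁻¹ ‖t p‖²` equal to `|Ψ p - Ψ z| + 1`.
        refine ⟨‖t p‖ ^ 2 / (|Ψ p - Ψ z| + 1), by positivity, ?_⟩
        rw [hΨp, inv_div, div_mul_cancel₀ _ htpos.ne']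
        linarith [le_abs_self (Ψ p - Ψ z)])
  -- The maximum is over the full ball and `p` may lie off the disc. This is harmless, since at
  -- every such `p` the derivative of `t` kills the direction corresponding to `v`.
  obtain ⟨p, hp, hpmax⟩ := UpperSemicontinuousOn.exists_isMaxOn (s := closedBall z ρ)
    ⟨z, mem_closedBall_self hρ.le⟩ (isCompact_closedBall z ρ)
    (fun p hp => (husc η⁻¹ p hp).upperSemicontinuousWithinAt _)
  have hpb : p ∈ ball z ρ := by
    rw [← closedBall_sdiff_sphere]
    refine ⟨hp, fun hps => ?_⟩
    have h1 := hsphere p hps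
    have h2 := hpmax (mem_closedBall_self hρ.le)
    simp only [Set.mem_ofPred_eq, htz, hQ', sub_self, norm_zero] at h2
    simp only [hQ'] at h1
    simp only [hΨ] at h1
    linarith
  obtain ⟨⟨h1, h2, h3, h4⟩, ⟨h5, h6, h7⟩, -⟩ := hball hp
  set b := fderiv ℂ G (F p) v with hb
  have hFb : fderiv ℂ F p b = v := by
    have hF' : HasFDerivAt F (fderiv ℂ F p) (G (F p)) := by
      rw [h6]; exact h4.differentiableAt.hasFDerivAt
    have hcomp := hF'.comp (F p) h5.differentiableAt.hasFDerivAt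
    have hid : HasFDerivAt (F ∘ G) (ContinuousLinearMap.id ℂ _) (F p) :=
      (hasFDerivAt_id (F p)).congr_of_eventuallyEq (by filter_upwards [h7] with x hx using hx)
    have := hcomp.unique hid
    have := congrArg (fun L => L v) this
    simpa using this
  have hb0 : b ≠ 0 := by
    intro h
    rw [h, map_zero] at hFb
    exact hv hFb.symm
  have htb : fderiv ℂ t p b = 0 := by
    have hd : HasFDerivAt (fun q => F q - F z) (fderiv ℂ F p) p :=
      h4.differentiableAt.hasFDerivAt.sub_const _
    have hd2 := hd.sub ((coord.hasFDerivAt.comp p hd).smul_const v)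
    have : fderiv ℂ t p = _ := hd2.fderiv
    rw [this]
    simp [hFb, hcv]
  exact hw.not_isLocalMax_sub_norm_sq hV h1 hb0 hQ'g (by linarith) h2 h3 δ (hta p h4) htb
    (inv_nonneg.mpr hη.le) (hpmax.isLocalMax (mem_of_superset (isOpen_ball.mem_nhds hpb)
      ball_subset_closedBall))

end MaximumPrinciple

/-! ### Jacobian determinants as derivations. -/

section Jacobian

variable {n : ℕ}

/-- The determinant of the Jacobian matrix of `n` functions on `ℂⁿ`. -/
noncomputable def jacobianDet (F : Fin n → EuclideanSpace ℂ (Fin n) → ℂ)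
    (z : EuclideanSpace ℂ (Fin n)) : ℂ :=
  (Matrix.of fun i k => fderiv ℂ (F i) z (EuclideanSpace.single k 1)).det

theorem analyticAt_jacobianDet {F : Fin n → EuclideanSpace ℂ (Fin n) → ℂ}
    {z : EuclideanSpace ℂ (Fin n)} (hF : ∀ i, AnalyticAt ℂ (F i) z) :
    AnalyticAt ℂ (jacobianDet F) z := by
  have : jacobianDet F = fun z => ∑ σ : Equiv.Perm (Fin n), ((Equiv.Perm.sign σ : ℤ) : ℂ) *
      ∏ i, fderiv ℂ (F (σ i)) z (EuclideanSpace.single i 1) := by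
    ext z
    simp [jacobianDet, Matrix.det_apply']
  rw [this]
  refine Finset.analyticAt_fun_sum _ fun σ _ => analyticAt_const.mul ?_
  refine Finset.analyticAt_fun_prod _ fun i _ => ?_
  exact ((ContinuousLinearMap.apply ℂ ℂ (EuclideanSpace.single i (1 : ℂ))).analyticAt _).fun_comp
    (hF (σ i)).fderiv

theorem sum_apply_single_mul (L : EuclideanSpace ℂ (Fin n) →L[ℂ] ℂ)
    (b : EuclideanSpace ℂ (Fin n)) :
    ∑ k, L (EuclideanSpace.single k 1) * b k = L b := by
  have : b = ∑ k, b k • EuclideanSpace.single k (1 : ℂ) := by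
    simpa using ((EuclideanSpace.basisFun (Fin n) ℂ).sum_repr b).symm
  conv_rhs => rw [this]
  simp [mul_comm]

theorem eq_zero_of_jacobianDet_ne_zero {F : Fin n → EuclideanSpace ℂ (Fin n) → ℂ}
    {z b : EuclideanSpace ℂ (Fin n)} (hF : jacobianDet F z ≠ 0)
    (hb : ∀ i, fderiv ℂ (F i) z b = 0) : b = 0 := by
  have := Matrix.eq_zero_of_mulVec_eq_zero hF (v := b.ofLp) (by
    ext i
    simp only [Matrix.mulVec, dotProduct, Matrix.of_apply, sum_apply_single_mul, hb,
      Pi.zero_apply])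
  ext i
  simp [this]

/-- Cramer's rule for the derivative along the vector dual to the `j`-th differential. -/
theorem fderiv_apply_mul_jacobianDet {F : Fin n → EuclideanSpace ℂ (Fin n) → ℂ}
    {z b : EuclideanSpace ℂ (Fin n)} {j : Fin n} (hF : jacobianDet F z ≠ 0)
    (hb : ∀ i, fderiv ℂ (F i) z b = (Pi.single j 1 : Fin n → ℂ) i)
    (h : EuclideanSpace ℂ (Fin n) → ℂ) :
    fderiv ℂ h z b * jacobianDet F z = jacobianDet (Function.update F j h) z := by
  set J : Matrix (Fin n) (Fin n) ℂ :=
    Matrix.of fun i k => fderiv ℂ (F i) z (EuclideanSpace.single k 1) with hJ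
  set row : Fin n → ℂ := fun k => fderiv ℂ h z (EuclideanSpace.single k 1) with hrow
  have hdet : J.det = jacobianDet F z := rfl
  have hunit : IsUnit J.det := isUnit_iff_ne_zero.mpr hF
  have hupd : jacobianDet (Function.update F j h) z = (J.updateRow j row).det := by
    unfold jacobianDet
    congr 1
    ext i k
    by_cases hij : i = j
    · subst hij; simp [hrow]
    · simp [hij, hJ, Matrix.updateRow_ne]
  set α : Fin n → ℂ := Matrix.vecMul row J⁻¹ with hα
  have hαJ : Matrix.vecMul α J = row := by
    rw [hα, Matrix.vecMul_vecMul, Matrix.nonsing_inv_mul _ hunit, Matrix.vecMul_one]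
  -- The differential of `h` expands in the differentials of the `F k`; only the `j`-th term
  -- survives in the determinant.
  have hrow2 : row = ∑ k, α k • J k := by
    rw [← hαJ, Matrix.vecMul_eq_sum]
  have hJb : Matrix.mulVec J b.ofLp = Pi.single j 1 := by
    ext i
    rw [← hb i, ← sum_apply_single_mul]
    rfl
  have hhb : fderiv ℂ h z b = α j := by
    rw [← sum_apply_single_mul]
    change row ⬝ᵥ b.ofLp = α j
    rw [← hαJ, ← Matrix.dotProduct_mulVec, hJb, dotProduct_single, mul_one]
  rw [hupd, hhb, ← hdet, hrow2, Matrix.det_updateRow_sum, smul_eq_mul]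

theorem jacobianDet_coordinates (z : EuclideanSpace ℂ (Fin n)) :
    jacobianDet (fun i q => q i) z = 1 := by
  have : (Matrix.of fun i k => fderiv ℂ (fun q : EuclideanSpace ℂ (Fin n) => q i) z
      (EuclideanSpace.single k 1)) = (1 : Matrix (Fin n) (Fin n) ℂ) := by
    ext i k
    have h : fderiv ℂ (fun q : EuclideanSpace ℂ (Fin n) => q i) z = EuclideanSpace.proj i :=
      (EuclideanSpace.proj i : EuclideanSpace ℂ (Fin n) →L[ℂ] ℂ).hasFDerivAt.fderiv
    simp [h, Matrix.one_apply]
  rw [jacobianDet, this, Matrix.det_one]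

/-- Along an immersed curve germ `c` there are `n` functions whose Jacobian determinant does not
vanish identically on `c`, but does so whenever the `j`-th of them is replaced by a function that
vanishes on `c`. -/
theorem exists_jacobianDet_update_vanishing {Ω : Set (EuclideanSpace ℂ (Fin n))}
    {c : ℂ → EuclideanSpace ℂ (Fin n)} (hc : AnalyticAt ℂ c 0) (hcΩ : ∀ᶠ ζ in 𝓝 0, c ζ ∈ Ω)
    (hc' : ∀ᶠ ζ in 𝓝 0, deriv c ζ ≠ 0) :
    ∃ (F : Fin n → EuclideanSpace ℂ (Fin n) → ℂ) (j : Fin n), (∀ i, AnalyticOnNhd ℂ (F i) Ω) ∧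
      (¬ ∀ᶠ ζ in 𝓝 0, jacobianDet F (c ζ) = 0) ∧
      ∀ h, AnalyticOnNhd ℂ h Ω → (∀ᶠ ζ in 𝓝 0, h (c ζ) = 0) →
        ∀ᶠ ζ in 𝓝 0, jacobianDet (Function.update F j h) (c ζ) = 0 := by
  classical
  -- Let as many of the functions as possible vanish on `c` while the Jacobian determinant does not
  -- vanish identically there.
  let P : Finset (Fin n) → Prop := fun s => ∃ F : Fin n → EuclideanSpace ℂ (Fin n) → ℂ,
    (∀ i, AnalyticOnNhd ℂ (F i) Ω) ∧ (∀ i ∈ s, ∀ᶠ ζ in 𝓝 0, F i (c ζ) = 0) ∧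
      ¬ ∀ᶠ ζ in 𝓝 0, jacobianDet F (c ζ) = 0
  have h0 : P ∅ := by
    refine ⟨fun i q => q i, fun i q _ => ?_, by simp, ?_⟩
    · exact (EuclideanSpace.proj i : EuclideanSpace ℂ (Fin n) →L[ℂ] ℂ).analyticAt q
    · simpa [jacobianDet_coordinates] using NeBot.ne inferInstance
  obtain ⟨s, hs⟩ := (Set.toFinite {s | P s}).exists_maximal ⟨∅, h0⟩
  obtain ⟨F, hF, hFs, hFdet⟩ := hs.prop
  have hj : ∃ j, j ∉ s := by
    by_contra! hall
    refine hFdet ?_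
    have hz : ∀ᶠ ζ in 𝓝 0, ∀ i, F i (c ζ) = 0 := eventually_all.mpr fun i => hFs i (hall i)
    -- If all the functions vanished on `c`, their differentials would all kill the nonzero vector
    -- `deriv c ζ`.
    filter_upwards [hz.eventually_nhds, hc', hc.eventually_analyticAt, hcΩ] with ζ h1 h2 h3 h4
    by_contra hne
    refine h2 (eq_zero_of_jacobianDet_ne_zero hne fun i => ?_)
    have hd := ((hF i _ h4).differentiableAt.hasFDerivAt).comp_hasDerivAt ζ
      h3.differentiableAt.hasDerivAt
    have hd0 : HasDerivAt (F i ∘ c) 0 ζ :=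
      (hasDerivAt_const ζ (0 : ℂ)).congr_of_eventuallyEq
        (by filter_upwards [h1] with x hx using hx i)
    exact hd.unique hd0
  obtain ⟨j, hj⟩ := hj
  refine ⟨F, j, hF, hFdet, fun h hh hh0 => ?_⟩
  by_contra hne
  have : P (insert j s) := by
    refine ⟨Function.update F j h, fun i => ?_, fun i hi => ?_, hne⟩
    · by_cases hij : i = j
      · subst hij; simpa using hh
      · simpa [hij] using hF i
    · by_cases hij : i = j
      · subst hij; simpa using hh0
      · simpa [hij] using hFs i ((Finset.mem_insert.mp hi).resolve_left hij)
  exact hj (hs.le_of_ge this (Finset.subset_insert j s) (Finset.mem_insert_self j s))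

end Jacobian

/-! ### Discs in common zero sets. -/

section LocalDiscs

/-- `A` contains the germ at `y` of an embedded holomorphic disc, which is a line through `y` in
the local coordinates `F` with inverse `G`. -/
def HasLocalDisc (n : ℕ) {Y : Type*} [TopologicalSpace Y]
    [ChartedSpace (EuclideanSpace ℂ (Fin n)) Y] (A : Set Y) (y : Y) : Prop :=
  ∃ (F : Y → EuclideanSpace ℂ (Fin n)) (G : EuclideanSpace ℂ (Fin n) → Y)
    (v : EuclideanSpace ℂ (Fin n)),
    ContMDiffAt 𝓘(ℂ, EuclideanSpace ℂ (Fin n)) 𝓘(ℂ, EuclideanSpace ℂ (Fin n)) ω F y ∧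
    ContMDiffAt 𝓘(ℂ, EuclideanSpace ℂ (Fin n)) 𝓘(ℂ, EuclideanSpace ℂ (Fin n)) ω G (F y) ∧
    (∀ᶠ q in 𝓝 y, G (F q) = q) ∧ (∀ᶠ x in 𝓝 (F y), F (G x) = x) ∧ v ≠ 0 ∧
    ∀ᶠ ζ : ℂ in 𝓝 0, G (F y + ζ • v) ∈ A

variable {n : ℕ}

theorem contMDiffAt_omega_iff_analyticAt {E F : Type*} [NormedAddCommGroup E] [NormedSpace ℂ E]
    [NormedAddCommGroup F] [NormedSpace ℂ F] [CompleteSpace F] {f : E → F} {x : E} :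
    ContMDiffAt 𝓘(ℂ, E) 𝓘(ℂ, F) ω f x ↔ AnalyticAt ℂ f x :=
  contMDiffAt_iff_contDiffAt.trans ⟨fun h => h.analyticAt, fun h => h.contDiffAt⟩

theorem HasLocalDisc.mem {Y : Type*} [TopologicalSpace Y]
    [ChartedSpace (EuclideanSpace ℂ (Fin n)) Y] {A : Set Y} {y : Y} (h : HasLocalDisc n A y) :
    y ∈ A := by
  obtain ⟨F, G, v, -, -, h1, -, -, h2⟩ := h
  have := h2.self_of_nhds
  rwa [zero_smul, add_zero, h1.self_of_nhds] at this

/-- A set of analytic functions that is closed under taking the Jacobian determinant with its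
elements put in the `j`-th place vanishes along an embedded disc through each of its common zeros
where the Jacobian determinant itself does not vanish. -/
theorem hasLocalDisc_commonZeros {Ω : Set (EuclideanSpace ℂ (Fin n))} (hΩ : IsOpen Ω)
    {I : Set (EuclideanSpace ℂ (Fin n) → ℂ)} (hI : ∀ h ∈ I, AnalyticOnNhd ℂ h Ω)
    {F : Fin n → EuclideanSpace ℂ (Fin n) → ℂ} (hF : ∀ i, AnalyticOnNhd ℂ (F i) Ω) {j : Fin n}
    (hIF : ∀ h ∈ I, jacobianDet (Function.update F j h) ∈ I) {z : EuclideanSpace ℂ (Fin n)}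
    (hz : z ∈ Ω) (hIz : ∀ h ∈ I, h z = 0) (hFz : jacobianDet F z ≠ 0) :
    HasLocalDisc n {q ∈ Ω | ∀ h ∈ I, h q = 0} z := by
  -- The functions `F` are local coordinates at `z` by the inverse function theorem. The disc sought
  -- is the `j`-th coordinate line.
  set Φ : EuclideanSpace ℂ (Fin n) → EuclideanSpace ℂ (Fin n) :=
    fun q => WithLp.toLp 2 fun i => F i q with hΦ
  have hΦa : ∀ q ∈ Ω, AnalyticAt ℂ Φ q := fun q hq =>
    ((PiLp.continuousLinearEquiv 2 ℂ fun _ : Fin n => ℂ).symm.analyticAt _).fun_comp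
      (AnalyticAt.pi fun i => hF i q hq)
  have hcoord : ∀ q ∈ Ω, ∀ b i, (fderiv ℂ Φ q b) i = fderiv ℂ (F i) q b := by
    intro q hq b i
    have h1 := (EuclideanSpace.proj i : EuclideanSpace ℂ (Fin n) →L[ℂ] ℂ).hasFDerivAt.comp q
      (hΦa q hq).differentiableAt.hasFDerivAt
    have h2 : fderiv ℂ (F i) q = _ := h1.fderiv
    rw [h2]
    rfl
  have hinj : Function.Injective (fderiv ℂ Φ z) := by
    rw [injective_iff_map_eq_zero]
    intro b hb
    refine eq_zero_of_jacobianDet_ne_zero hFz fun i => ?_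
    rw [← hcoord z hz, hb]
    rfl
  set e : EuclideanSpace ℂ (Fin n) ≃L[ℂ] EuclideanSpace ℂ (Fin n) :=
    (LinearEquiv.ofInjectiveEndo (fderiv ℂ Φ z : EuclideanSpace ℂ (Fin n) →ₗ[ℂ] _)
      hinj).toContinuousLinearEquiv with he
  have hder : HasFDerivAt Φ (e : EuclideanSpace ℂ (Fin n) →L[ℂ] EuclideanSpace ℂ (Fin n)) z := by
    have heq : (e : EuclideanSpace ℂ (Fin n) →L[ℂ] EuclideanSpace ℂ (Fin n)) = fderiv ℂ Φ z := by
      ext1 x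
      rfl
    rw [heq]
    exact (hΦa z hz).differentiableAt.hasFDerivAt
  have hcd : ContDiffAt ℂ ω Φ z := (hΦa z hz).contDiffAt
  have hstrict := hcd.hasStrictFDerivAt' hder (by simp)
  set G := hcd.localInverse hder (by simp) with hG
  have hGa : AnalyticAt ℂ G (Φ z) := (hcd.to_localInverse hder (by simp)).analyticAt
  have hGΦ : ∀ᶠ q in 𝓝 z, G (Φ q) = q := hstrict.eventually_left_inverse
  have hΦG : ∀ᶠ x in 𝓝 (Φ z), Φ (G x) = x := hstrict.eventually_right_inverse
  set v : EuclideanSpace ℂ (Fin n) := EuclideanSpace.single j 1 with hv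
  refine ⟨Φ, G, v, contMDiffAt_omega_iff_analyticAt.mpr (hΦa z hz),
    contMDiffAt_omega_iff_analyticAt.mpr hGa, hGΦ, hΦG, by simp [hv], ?_⟩
  set γ : ℂ → EuclideanSpace ℂ (Fin n) := fun ζ => G (Φ z + ζ • v) with hγ
  have hγ0 : γ 0 = z := by simp [hγ, hGΦ.self_of_nhds]
  have hline : Tendsto (fun ζ : ℂ => Φ z + ζ • v) (𝓝 0) (𝓝 (Φ z)) := by
    have : Continuous fun ζ : ℂ => Φ z + ζ • v := by fun_prop
    simpa using this.tendsto 0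
  have hγa0 : AnalyticAt ℂ γ 0 :=
    AnalyticAt.fun_comp (g := G) (by simpa using hGa) (by fun_prop)
  have hJa : ∀ q ∈ Ω, AnalyticAt ℂ (jacobianDet F) q := fun q hq =>
    analyticAt_jacobianDet fun i => hF i q hq
  have hev : ∀ᶠ ζ in 𝓝 0, AnalyticAt ℂ γ ζ ∧ γ ζ ∈ Ω ∧ jacobianDet F (γ ζ) ≠ 0 ∧
      ∀ᶠ ξ in 𝓝 ζ, Φ (γ ξ) = Φ z + ξ • v := by
    have h1 : ∀ᶠ q in 𝓝 (γ 0), q ∈ Ω := hγ0 ▸ hΩ.mem_nhds hz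
    have h2 : ∀ᶠ q in 𝓝 (γ 0), jacobianDet F q ≠ 0 :=
      hγ0 ▸ (hJa z hz).continuousAt.eventually_ne hFz
    filter_upwards [hγa0.eventually_analyticAt, hγa0.continuousAt.eventually h1,
      hγa0.continuousAt.eventually h2, (hline.eventually hΦG).eventually_nhds]
      with ζ a1 a2 a3 a4 using ⟨a1, a2, a3, a4⟩
  obtain ⟨ρ, hρ, hball⟩ := Metric.eventually_nhds_iff_ball.mp hev
  have hha : ∀ h ∈ I, AnalyticOnNhd ℂ (fun ζ => h (γ ζ)) (ball 0 ρ) := fun h hh ζ hζ =>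
    (hI h hh _ (hball ζ hζ).2.1).fun_comp (hball ζ hζ).1
  have h0mem : (0 : ℂ) ∈ ball (0 : ℂ) ρ := mem_ball_self hρ
  have hderiv : ∀ h ∈ I, ∀ ζ ∈ ball (0 : ℂ) ρ, deriv (fun ζ => h (γ ζ)) ζ * jacobianDet F (γ ζ) =
      jacobianDet (Function.update F j h) (γ ζ) := by
    intro h hh ζ hζ
    obtain ⟨a1, a2, a3, a4⟩ := hball ζ hζ
    have hγd := a1.differentiableAt.hasDerivAt
    have hd := ((hI h hh _ a2).differentiableAt.hasFDerivAt).comp_hasDerivAt ζ hγd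
    have hd' : deriv (fun ζ => h (γ ζ)) ζ = _ := hd.deriv
    rw [hd']
    refine fderiv_apply_mul_jacobianDet a3 (fun i => ?_) h
    have hdi := ((hF i _ a2).differentiableAt.hasFDerivAt).comp_hasDerivAt ζ hγd
    have hdi' : HasDerivAt (F i ∘ γ) (v i) ζ := by
      have : HasDerivAt (fun ξ : ℂ => (Φ z) i + ξ * v i) (v i) ζ := by
        simpa using ((hasDerivAt_id ζ).mul_const (v i)).const_add ((Φ z) i)
      refine this.congr_of_eventuallyEq ?_
      filter_upwards [a4] with ξ hξ
      have := congrArg (fun x : EuclideanSpace ℂ (Fin n) => x i) hξ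
      simpa [hΦ] using this
    rw [hdi.unique hdi']
    simp [hv, Pi.single_apply]
  -- Up to a nonvanishing factor, the derivative of `h ∘ γ` is the restriction to `γ` of another
  -- element of `I`. Each differentiation thus raises the order by one, and all orders are infinite.
  have hord : ∀ N : ℕ, ∀ h ∈ I, (N : ℕ∞) ≤ analyticOrderAt (fun ζ => h (γ ζ)) 0 := by
    intro N
    induction N with
    | zero => simp
    | succ N ih =>
      intro h hh
      have han := hha h hh 0 h0mem
      have hzero : h (γ 0) = 0 := hγ0 ▸ hIz h hh
      have hJ0 : AnalyticAt ℂ (fun ζ => jacobianDet F (γ ζ)) 0 :=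
        (hJa _ (hball 0 h0mem).2.1).fun_comp hγa0
      have hJord : analyticOrderAt (fun ζ => jacobianDet F (γ ζ)) 0 = 0 :=
        hJ0.analyticOrderAt_eq_zero.mpr (hball 0 h0mem).2.2.1
      have hmul : analyticOrderAt (deriv (fun ζ => h (γ ζ)) * fun ζ => jacobianDet F (γ ζ)) 0 =
          analyticOrderAt (fun ζ => jacobianDet (Function.update F j h) (γ ζ)) 0 := by
        refine analyticOrderAt_congr ?_
        filter_upwards [isOpen_ball.mem_nhds h0mem] with ζ hζ using hderiv h hh ζ hζ
      rw [analyticOrderAt_mul han.deriv hJ0, hJord, add_zero] at hmul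
      have h1 := han.analyticOrderAt_deriv_add_one
      simp only [hzero, sub_zero] at h1
      rw [← h1, hmul, Nat.cast_succ]
      gcongr
      exact ih _ (hIF h hh)
  filter_upwards [isOpen_ball.mem_nhds h0mem] with ζ hζ
  refine ⟨(hball ζ hζ).2.1, fun h hh => ?_⟩
  have htop : analyticOrderAt (fun ζ => h (γ ζ)) 0 = ⊤ :=
    ENat.eq_top_iff_forall_ge.mpr fun N => hord N h hh
  exact (hha h hh).eqOn_zero_of_preconnected_of_eventuallyEq_zero
    (convex_ball 0 ρ).isPreconnected h0mem (analyticOrderAt_eq_top.mp htop) hζ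

end LocalDiscs

/-! ### Maximum principle on analytic sets. -/

section AnalyticMaximumPrinciple

open Real

variable {n : ℕ}

theorem HasLocalDisc.mono {Y : Type*} [TopologicalSpace Y]
    [ChartedSpace (EuclideanSpace ℂ (Fin n)) Y] {A B : Set Y} {y : Y} (h : HasLocalDisc n A y)
    (hAB : A ⊆ B) : HasLocalDisc n B y := by
  obtain ⟨F, G, v, hF, hG, hGF, hFG, hv, hA⟩ := h
  exact ⟨F, G, v, hF, hG, hGF, hFG, hv, hA.mono fun ζ hζ => hAB hζ⟩

theorem isClosed_closedBall_inter_commonZeros {Ω : Set (EuclideanSpace ℂ (Fin n))}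
    {I : Set (EuclideanSpace ℂ (Fin n) → ℂ)} (hI : ∀ h ∈ I, ContinuousOn h Ω)
    {p : EuclideanSpace ℂ (Fin n)} {ρ : ℝ} (hρ : closedBall p ρ ⊆ Ω) :
    IsClosed {q ∈ closedBall p ρ | ∀ h ∈ I, h q = 0} := by
  have : {q ∈ closedBall p ρ | ∀ h ∈ I, h q = 0} =
      closedBall p ρ ∩ ⋂ h ∈ I, (closedBall p ρ ∩ h ⁻¹' {0}) := by
    ext q
    simp only [mem_ofPred_eq, mem_inter_iff, mem_iInter, mem_preimage, mem_singleton_iff]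
    exact ⟨fun h => ⟨h.1, fun f hf => ⟨h.1, h.2 f hf⟩⟩, fun h => ⟨h.1, fun f hf => (h.2 f hf).2⟩⟩
  rw [this]
  exact isClosed_closedBall.inter (isClosed_biInter fun h hh =>
    ((hI h hh).mono hρ).preimage_isClosed_of_isClosed isClosed_closedBall isClosed_singleton)

/-- The maximum principle on the common zeros, in a ball, of a set `I` of analytic functions that
contains discs wherever `g ≠ 0`. -/
theorem IsPlurisubharmonicOn.le_of_hasLocalDisc_commonZeros
    {w : EuclideanSpace ℂ (Fin n) → ℝ} {Ω : Set (EuclideanSpace ℂ (Fin n))}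
    (hw : IsPlurisubharmonicOn w Ω) (hΩ : IsOpen Ω) {Q : EuclideanSpace ℂ (Fin n) → ℝ} {κ : ℝ}
    (hQ : CircleGrowth Q κ) (hκ : 0 < κ) {I : Set (EuclideanSpace ℂ (Fin n) → ℂ)}
    (hI : ∀ h ∈ I, AnalyticOnNhd ℂ h Ω) {g : EuclideanSpace ℂ (Fin n) → ℂ}
    (hg : AnalyticOnNhd ℂ g Ω)
    (hdisc : ∀ q ∈ Ω, (∀ h ∈ I, h q = 0) → g q ≠ 0 → HasLocalDisc n {q ∈ Ω | ∀ h ∈ I, h q = 0} q)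
    {p : EuclideanSpace ℂ (Fin n)} {ρ C : ℝ} (hρΩ : closedBall p ρ ⊆ Ω)
    (hC : ∀ q ∈ sphere p ρ, (∀ h ∈ I, h q = 0) → g q ≠ 0 → w q + Q q ≤ C)
    {y : EuclideanSpace ℂ (Fin n)} (hy : y ∈ ball p ρ) (hIy : ∀ h ∈ I, h y = 0)
    (hgy : g y ≠ 0) : w y + Q y ≤ C := by
  by_contra! hlt
  have hyc : y ∈ closedBall p ρ := ball_subset_closedBall hy
  have husc : UpperSemicontinuousOn (fun q => w q + Q q) (closedBall p ρ) :=
    (hw.1.mono hρΩ).add hQ.1.continuousOn.upperSemicontinuousOn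
  obtain ⟨B, hB⟩ := husc.bddAbove_of_isCompact (isCompact_closedBall p ρ)
  replace hB : ∀ q ∈ closedBall p ρ, w q + Q q ≤ B := fun q hq => hB (mem_image_of_mem _ hq)
  have hgc : ContinuousOn (fun q => ‖g q‖) (closedBall p ρ) :=
    (hg.continuousOn.mono hρΩ).norm
  obtain ⟨X, hX⟩ := (isCompact_closedBall p ρ).bddAbove_image hgc
  replace hX : ∀ q ∈ closedBall p ρ, ‖g q‖ ≤ X := fun q hq => hX (mem_image_of_mem _ hq)
  have hgy0 : 0 < ‖g y‖ := norm_pos_iff.mpr hgy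
  have hlogy : log ‖g y‖ ≤ log X := log_le_log hgy0 (hX y hyc)
  -- With `δ` this small, the value at `y` still exceeds every value on the sphere.
  obtain ⟨δ, hδ, hδL⟩ : ∃ δ > 0, C + δ * log X < w y + Q y + δ * log ‖g y‖ := by
    have h1 : 0 < log X - log ‖g y‖ + 1 := by linarith
    refine ⟨(w y + Q y - C) / (2 * (log X - log ‖g y‖ + 1)),
      div_pos (by linarith) (by positivity), ?_⟩
    have h2 : (w y + Q y - C) / (2 * (log X - log ‖g y‖ + 1)) * (log X - log ‖g y‖ + 1) =
        (w y + Q y - C) / 2 := by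
      field_simp
    have h3 : 0 < (w y + Q y - C) / (2 * (log X - log ‖g y‖ + 1)) :=
      div_pos (by linarith) (by positivity)
    nlinarith
  set L := w y + Q y + δ * log ‖g y‖ with hL
  -- Where `‖g‖ = θ` the barrier pushes the function below `L`, so the maximum over `S` lies off
  -- that artificial boundary.
  obtain ⟨θ, hθ, hθL⟩ : ∃ θ > 0, B + δ * log θ < L := by
    refine ⟨exp ((L - B) / δ - 1), exp_pos _, ?_⟩
    rw [log_exp, mul_sub, mul_div_cancel₀ _ hδ.ne']
    linarith
  set S : Set (EuclideanSpace ℂ (Fin n)) := {q ∈ closedBall p ρ | ∀ h ∈ I, h q = 0} ∩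
    (closedBall p ρ ∩ (fun q => ‖g q‖) ⁻¹' Ici θ) with hS
  have hScl : IsClosed S :=
    (isClosed_closedBall_inter_commonZeros (fun h hh => (hI h hh).continuousOn) hρΩ).inter
      (hgc.preimage_isClosed_of_isClosed isClosed_closedBall isClosed_Ici)
  have hSc : IsCompact S :=
    (isCompact_closedBall p ρ).of_isClosed_subset hScl fun q hq => hq.1.1
  have hyS : y ∈ S := by
    refine ⟨⟨hyc, hIy⟩, hyc, ?_⟩
    by_contra hlt'
    have h1 : ‖g y‖ < θ := not_le.mp hlt'
    have := mul_lt_mul_of_pos_left (log_lt_log hgy0 h1) hδ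
    have := hB y hyc
    linarith
  have husc2 : UpperSemicontinuousOn (fun q => w q + Q q + δ * log ‖g q‖) S := by
    refine (husc.mono fun q hq => hq.1.1).add (ContinuousOn.upperSemicontinuousOn ?_)
    refine continuousOn_const.mul ((hgc.mono fun q hq => hq.1.1).log fun q hq => ?_)
    exact (hθ.trans_le hq.2.2).ne'
  obtain ⟨z, hzS, hzmax⟩ := husc2.exists_isMaxOn ⟨y, hyS⟩ hSc
  have hLz : L ≤ w z + Q z + δ * log ‖g z‖ := hzmax hyS
  obtain ⟨⟨hzc, hIz⟩, -, hθz⟩ := hzS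
  have hzΩ : z ∈ Ω := hρΩ hzc
  have hθz' : θ < ‖g z‖ := by
    refine lt_of_le_of_ne hθz fun heq => ?_
    rw [← heq] at hLz
    linarith [hB z hzc]
  have hgz : g z ≠ 0 := norm_pos_iff.mp (hθ.trans hθz')
  have hzb : z ∈ ball p ρ := by
    rw [← closedBall_sdiff_sphere]
    refine ⟨hzc, fun hzs => ?_⟩
    have h1 := hC z hzs hIz hgz
    have h2 := mul_le_mul_of_nonneg_left (log_le_log (hθ.trans hθz') (hX z hzc)) hδ.le
    linarith
  obtain ⟨F, G, v, hF, hG, hGF, hFG, hv, hA⟩ := hdisc z hzΩ hIz hgz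
  rw [contMDiffAt_omega_iff_analyticAt] at hF hG
  refine hw.not_isLocalMax_along_disc hΩ hzΩ hQ hκ (hg z hzΩ) hgz δ hF hG hGF hFG hv ?_
  have hc : Tendsto (fun ζ : ℂ => G (F z + ζ • v)) (𝓝 0) (𝓝 z) := by
    have h1 : Tendsto (fun ζ : ℂ => F z + ζ • v) (𝓝 0) (𝓝 (F z)) := by
      have : Continuous fun ζ : ℂ => F z + ζ • v := by fun_prop
      simpa using this.tendsto 0
    have h2 := hG.continuousAt.tendsto.comp h1
    rwa [hGF.self_of_nhds] at h2
  filter_upwards [hA, hc.eventually (isOpen_ball.mem_nhds hzb),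
    hc.eventually ((hg z hzΩ).continuousAt.norm.eventually (lt_mem_nhds hθz'))] with ζ h1 h2 h3
  exact hzmax ⟨⟨ball_subset_closedBall h2, h1.2⟩, ball_subset_closedBall h2, h3.le⟩

/-- The maximum principle in a ball for strictly plurisubharmonic functions on the points of an
analytic set through which it contains a disc. -/
theorem IsPlurisubharmonicOn.le_of_hasLocalDisc
    {w : EuclideanSpace ℂ (Fin n) → ℝ} {Ω : Set (EuclideanSpace ℂ (Fin n))}
    (hw : IsPlurisubharmonicOn w Ω) (hΩ : IsOpen Ω) {Q : EuclideanSpace ℂ (Fin n) → ℝ} {κ : ℝ}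
    (hQ : CircleGrowth Q κ) (hκ : 0 < κ) {A : Set (EuclideanSpace ℂ (Fin n))} {m : ℕ}
    {f : Fin m → EuclideanSpace ℂ (Fin n) → ℂ} (hf : ∀ i, AnalyticOnNhd ℂ (f i) Ω)
    (hA : ∀ q ∈ Ω, q ∈ A ↔ ∀ i, f i q = 0)
    {p : EuclideanSpace ℂ (Fin n)} {ρ C : ℝ} (hρΩ : closedBall p ρ ⊆ Ω)
    (hC : ∀ q ∈ sphere p ρ, HasLocalDisc n A q → w q + Q q ≤ C)
    {y : EuclideanSpace ℂ (Fin n)} (hy : y ∈ ball p ρ) (hyA : HasLocalDisc n A y) :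
    w y + Q y ≤ C := by
  obtain ⟨F₀, G₀, v, hF₀, hG₀, hGF, hFG, hv, hdA⟩ := hyA
  rw [contMDiffAt_omega_iff_analyticAt] at hF₀ hG₀
  have hyΩ : y ∈ Ω := hρΩ (ball_subset_closedBall hy)
  set c : ℂ → EuclideanSpace ℂ (Fin n) := fun ζ => G₀ (F₀ y + ζ • v) with hc
  have hc0 : c 0 = y := by simp [hc, hGF.self_of_nhds]
  have hca : AnalyticAt ℂ c 0 :=
    AnalyticAt.fun_comp (g := G₀) (by simpa using hG₀) (by fun_prop)
  have hct : Tendsto c (𝓝 0) (𝓝 y) := by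
    have := hca.continuousAt.tendsto
    rwa [hc0] at this
  have hline : Tendsto (fun ζ : ℂ => F₀ y + ζ • v) (𝓝 0) (𝓝 (F₀ y)) := by
    have : Continuous fun ζ : ℂ => F₀ y + ζ • v := by fun_prop
    simpa using this.tendsto 0
  have hcd : deriv c 0 ≠ 0 := by
    intro h0
    have hF₀' : HasFDerivAt F₀ (fderiv ℂ F₀ y) (c 0) := by
      rw [hc0]; exact hF₀.differentiableAt.hasFDerivAt
    have h1 := hF₀'.comp_hasDerivAt (0 : ℂ) hca.differentiableAt.hasDerivAt
    rw [h0, map_zero] at h1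
    have h2 : HasDerivAt (F₀ ∘ c) v 0 := by
      have : HasDerivAt (fun ζ : ℂ => F₀ y + ζ • v) v 0 := by
        simpa using ((hasDerivAt_id (0 : ℂ)).smul_const v).const_add (F₀ y)
      exact this.congr_of_eventuallyEq (hline.eventually hFG)
    exact hv (h2.unique h1)
  have hcΩ : ∀ᶠ ζ in 𝓝 0, c ζ ∈ Ω := hct.eventually (hΩ.mem_nhds hyΩ)
  obtain ⟨F, j, hF, hFdet, hFI⟩ := exists_jacobianDet_update_vanishing hca hcΩ
    (hca.deriv.continuousAt.eventually_ne hcd)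
  set I : Set (EuclideanSpace ℂ (Fin n) → ℂ) :=
    {h | AnalyticOnNhd ℂ h Ω ∧ ∀ᶠ ζ in 𝓝 0, h (c ζ) = 0} with hI
  have hIF : ∀ h ∈ I, jacobianDet (Function.update F j h) ∈ I := by
    rintro h ⟨hh, hh0⟩
    refine ⟨fun q hq => analyticAt_jacobianDet fun i => ?_, hFI h hh hh0⟩
    by_cases hij : i = j
    · subst hij; simpa using hh q hq
    · simpa [hij] using hF i q hq
  have hIA : {q ∈ Ω | ∀ h ∈ I, h q = 0} ⊆ A := by
    rintro q ⟨hqΩ, hq⟩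
    refine (hA q hqΩ).mpr fun i => hq _ ⟨hf i, ?_⟩
    filter_upwards [hdA, hcΩ] with ζ h1 h2 using (hA _ h2).mp h1 i
  have hdisc : ∀ q ∈ Ω, (∀ h ∈ I, h q = 0) → jacobianDet F q ≠ 0 →
      HasLocalDisc n {q ∈ Ω | ∀ h ∈ I, h q = 0} q := fun q hq hIq hFq =>
    hasLocalDisc_commonZeros hΩ (fun h hh => hh.1) hF hIF hq hIq hFq
  have hga : AnalyticOnNhd ℂ (jacobianDet F) Ω := fun q hq =>
    analyticAt_jacobianDet fun i => hF i q hq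
  have hle : ∀ q ∈ ball p ρ, (∀ h ∈ I, h q = 0) → jacobianDet F q ≠ 0 → w q + Q q ≤ C :=
    fun q hq hIq hFq => hw.le_of_hasLocalDisc_commonZeros hΩ hQ hκ (fun h hh => hh.1) hga hdisc
      hρΩ (fun q hq hIq hFq => hC q hq ((hdisc q (hρΩ (sphere_subset_closedBall hq)) hIq
        hFq).mono hIA)) hq hIq hFq
  -- The identity theorem on one disc gives a radius valid for all of the infinite set `I`.
  have hcI : ∀ᶠ ζ in 𝓝 0, ∀ h ∈ I, h (c ζ) = 0 := by
    obtain ⟨r, hr, hball⟩ := Metric.eventually_nhds_iff_ball.mp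
      (hca.eventually_analyticAt.and hcΩ)
    filter_upwards [isOpen_ball.mem_nhds (mem_ball_self hr)] with ζ hζ h hh
    have : AnalyticOnNhd ℂ (fun ζ => h (c ζ)) (ball 0 r) := fun ξ hξ =>
      (hh.1 _ (hball ξ hξ).2).fun_comp (hball ξ hξ).1
    exact this.eqOn_zero_of_preconnected_of_eventuallyEq_zero
      (convex_ball 0 r).isPreconnected (mem_ball_self hr) hh.2 hζ
  have hgc : AnalyticAt ℂ (fun ζ => jacobianDet F (c ζ)) 0 :=
    (hga _ (hc0 ▸ hyΩ)).fun_comp hca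
  have hgne : ∀ᶠ ζ in 𝓝[≠] 0, jacobianDet F (c ζ) ≠ 0 :=
    hgc.eventually_eq_zero_or_eventually_ne_zero.resolve_left hFdet
  by_contra! hlt
  -- The bound holds on `c` near `y` except perhaps at `y` itself, where the determinant may vanish.
  -- Its failure there would make `y` a local maximum along `c`; no barrier is needed.
  refine hw.not_isLocalMax_along_disc hΩ hyΩ hQ hκ (g := fun _ => 1) analyticAt_const one_ne_zero 0
    hF₀ hG₀ hGF hFG hv ?_
  filter_upwards [eventually_nhdsWithin_iff.mp hgne, hcI, hct.eventually (isOpen_ball.mem_nhds hy)]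
    with ζ h1 h2 h3
  simp only [zero_mul, add_zero]
  by_cases hζ : ζ = 0
  · change w (c ζ) + Q (c ζ) ≤ _
    rw [hζ, hc0]
  · exact (hle _ h3 h2 (h1 hζ)).trans hlt.le

/-- The same maximum principle for a set that is merely locally analytic in the ball. -/
theorem IsPlurisubharmonicOn.le_of_hasLocalDisc_of_locally
    {w : EuclideanSpace ℂ (Fin n) → ℝ} {a : EuclideanSpace ℂ (Fin n)} {r : ℝ}
    (hw : IsPlurisubharmonicOn w (ball a r))
    {Q : EuclideanSpace ℂ (Fin n) → ℝ} {κ : ℝ} (hQ : CircleGrowth Q κ) (hκ : 0 < κ)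
    {A : Set (EuclideanSpace ℂ (Fin n))}
    (hA : ∀ p ∈ ball a r, ∃ Ω, IsOpen Ω ∧ p ∈ Ω ∧ ∃ (m : ℕ) (f : Fin m → _ → ℂ),
      (∀ i, AnalyticOnNhd ℂ (f i) Ω) ∧ ∀ q ∈ Ω, q ∈ A ↔ ∀ i, f i q = 0)
    {M : ℝ} (hM : ∀ q ∈ ball a r, HasLocalDisc n A q → w q + Q q ≤ M)
    {y : EuclideanSpace ℂ (Fin n)} (hy : y ∈ ball a r) (hyA : HasLocalDisc n A y) :
    w y + Q y - κ / 2 * ‖y - a‖ ^ 2 ≤ M - κ / 2 * r ^ 2 := by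
  by_contra! hlt
  set Q' : EuclideanSpace ℂ (Fin n) → ℝ := fun q => Q q - κ / 2 * ‖q - a‖ ^ 2 with hQ'
  have hQ'g : CircleGrowth Q' (κ - κ / 2 * 1) :=
    hQ.sub ((circleGrowth_norm_sub_sq a).const_mul (κ / 2))
  set S : Set (EuclideanSpace ℂ (Fin n)) := {q ∈ ball a r | HasLocalDisc n A q} with hS
  set u : EuclideanSpace ℂ (Fin n) → ℝ := fun q => w q + Q' q with hu
  have huM : ∀ q ∈ S, u q ≤ M - κ / 2 * ‖q - a‖ ^ 2 := by
    rintro q ⟨hq, hqA⟩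
    have := hM q hq hqA
    simp only [hu, hQ']
    linarith
  have hyS : y ∈ S := ⟨hy, hyA⟩
  have hbdd : BddAbove (u '' S) := by
    refine ⟨M, ?_⟩
    rintro _ ⟨q, hq, rfl⟩
    have := huM q hq
    have : 0 ≤ κ / 2 * ‖q - a‖ ^ 2 := by positivity
    linarith
  set m := sSup (u '' S) with hm
  have hum : ∀ q ∈ S, u q ≤ m := fun q hq => le_csSup hbdd (mem_image_of_mem u hq)
  have hCm : M - κ / 2 * r ^ 2 < m := by
    refine lt_of_lt_of_le ?_ (hum y hyS)
    simp only [hu, hQ']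
    linarith
  -- The supremum `m` over `S` need not be attained, so gaps are used. Inside the ball another
  -- quarter of `κ` buys the gap, leaving growth `κ / 4`; near the boundary `u` is close to or below
  -- `M - κ / 2 * r ^ 2`, which is less than `m`.
  obtain ⟨η, hη, hle⟩ := (isCompact_closedBall a r).exists_pos_forall
    (P := fun q η => q ∈ S → u q ≤ m - η)
    (fun q η η' _ h h1 hq => (h1 hq).trans (by linarith))
    (by
      intro p hp
      by_cases hpb : p ∈ ball a r
      · obtain ⟨Ω, hΩ, hpΩ, k, f, hf, hfA⟩ := hA p hpb
        have hΩ' : IsOpen (Ω ∩ ball a r) := hΩ.inter isOpen_ball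
        obtain ⟨ρ, hρ, hρΩ⟩ := nhds_basis_closedBall.mem_iff.mp (hΩ'.mem_nhds ⟨hpΩ, hpb⟩)
        have hQ''g : CircleGrowth (fun q => Q' q - κ / 4 * ‖q - p‖ ^ 2)
            (κ - κ / 2 * 1 - κ / 4 * 1) :=
          hQ'g.sub ((circleGrowth_norm_sub_sq p).const_mul (κ / 4))
        refine ⟨κ / 4 * (ρ ^ 2 - (ρ / 2) ^ 2), mul_pos (by linarith) (by nlinarith), ?_⟩
        filter_upwards [isOpen_ball.mem_nhds (mem_ball_self (half_pos hρ))] with q hq hqS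
        have key := (hw.mono (W := Ω ∩ ball a r) inter_subset_right).le_of_hasLocalDisc hΩ'
          hQ''g (by linarith) (A := A) (f := f) (fun i => (hf i).mono inter_subset_left)
          (fun q hq => hfA q hq.1) hρΩ (C := m - κ / 4 * ρ ^ 2)
          (by
            intro q hq hqA
            have h1 := hum q ⟨(hρΩ (sphere_subset_closedBall hq)).2, hqA⟩
            rw [mem_sphere_iff_norm] at hq
            simp only [hu] at h1
            rw [hq]
            linarith)
          (ball_subset_ball (by linarith) hq) hqS.2
        have h2 : ‖q - p‖ ^ 2 ≤ (ρ / 2) ^ 2 := by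
          rw [mem_ball_iff_norm] at hq
          gcongr
        have h3 : κ / 4 * ‖q - p‖ ^ 2 ≤ κ / 4 * (ρ / 2) ^ 2 :=
          mul_le_mul_of_nonneg_left h2 (by linarith)
        simp only [hu]
        linarith
      · have hpn : ‖p - a‖ = r := by
          rw [mem_closedBall_iff_norm] at hp
          rw [mem_ball_iff_norm, not_lt] at hpb
          exact le_antisymm hp hpb
        refine ⟨(m - (M - κ / 2 * r ^ 2)) / 2, by linarith, ?_⟩
        have hcont : ContinuousAt (fun q => M - κ / 2 * ‖q - a‖ ^ 2) p := by fun_prop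
        have hlt : M - κ / 2 * ‖p - a‖ ^ 2 < m - (m - (M - κ / 2 * r ^ 2)) / 2 := by
          rw [hpn]; linarith
        filter_upwards [hcont.eventually (gt_mem_nhds hlt)] with q hq hqS
        exact (huM q hqS).trans hq.le)
  have : m ≤ m - η := by
    refine csSup_le ⟨_, mem_image_of_mem u hyS⟩ ?_
    rintro _ ⟨q, hq, rfl⟩
    exact hle q (ball_subset_closedBall hq.1) hq
  linarith

end AnalyticMaximumPrinciple

/-! ### Transfer of discs and estimates through the covering. -/

section Coverings

theorem IsEvenlyCovered.exists_section {X E I : Type*} [TopologicalSpace X] [TopologicalSpace E]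
    [TopologicalSpace I] {f : E → X} {x : X} (h : IsEvenlyCovered f x I) :
    ∃ U : Set X, IsOpen U ∧ x ∈ U ∧ ∀ y, f y ∈ U →
      ∃ s : X → E, ContinuousOn s U ∧ (∀ u ∈ U, f (s u) = u) ∧ s (f y) = y := by
  classical
  obtain ⟨-, U, hxU, hU, -, H, hH⟩ := h
  refine ⟨U, hU, hxU, fun y hy => ?_⟩
  set i := (H ⟨y, hy⟩).2 with hi
  -- Off `U` the value `y` is a mere filler.
  refine ⟨fun u => if hu : u ∈ U then H.symm (⟨u, hu⟩, i) else y, ?_, fun u hu => ?_, ?_⟩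
  · rw [continuousOn_iff_continuous_domRestrict]
    have : Continuous fun u : U => ((H.symm (u, i) : f ⁻¹' U) : E) := by fun_prop
    refine this.congr fun u => ?_
    simp [u.2]
  · simp only [hu, dif_pos]
    rw [← hH, H.apply_symm_apply]
  · have hy' : ((⟨f y, hy⟩ : U), i) = H ⟨y, hy⟩ :=
      Prod.ext (Subtype.ext (hH ⟨y, hy⟩).symm) rfl
    simp only [hy, dif_pos]
    rw [hy', H.symm_apply_apply]

variable {n : ℕ} {D : Type*} [TopologicalSpace D] [ChartedSpace (EuclideanSpace ℂ (Fin n)) D]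
  {Y : Type*} [TopologicalSpace Y] [ChartedSpace (EuclideanSpace ℂ (Fin n)) Y]

/-- A continuous local section of a local biholomorphism is a local holomorphic inverse. -/
theorem IsLocalDiffeomorphAt.contMDiffAt_section {π : Y → D} {U : Set D} (hU : IsOpen U)
    {s : D → Y} (hs : ContinuousOn s U) (hπs : ∀ u ∈ U, π (s u) = u) {u : D} (hu : u ∈ U)
    (hπ : IsLocalDiffeomorphAt 𝓘(ℂ, EuclideanSpace ℂ (Fin n)) 𝓘(ℂ, EuclideanSpace ℂ (Fin n)) ω
      π (s u)) :
    ContMDiffAt 𝓘(ℂ, EuclideanSpace ℂ (Fin n)) 𝓘(ℂ, EuclideanSpace ℂ (Fin n)) ω s u ∧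
      ∀ᶠ q in 𝓝 (s u), s (π q) = q := by
  have hsu : ContinuousAt s u := hs.continuousAt (hU.mem_nhds hu)
  have hinv := hπ.localInverse_eventuallyEq_left
  have hcont := hπ.localInverse_contMDiffAt
  have hπc : Tendsto π (𝓝 (s u)) (𝓝 u) := by
    have := hπ.contMDiffAt.continuousAt.tendsto
    rwa [hπs u hu] at this
  rw [hπs u hu] at hcont
  have heq : s =ᶠ[𝓝 u] hπ.localInverse := by
    filter_upwards [hsu.eventually hinv, hU.mem_nhds hu] with v h1 h2
    have : hπ.localInverse (π (s v)) = s v := h1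
    rw [hπs v h2] at this
    exact this.symm
  refine ⟨hcont.congr_of_eventuallyEq heq, ?_⟩
  filter_upwards [hπc.eventually heq, hinv] with q h1 h2
  rw [h1]
  exact h2

theorem HasLocalDisc.map {A : Set D} {B : Set Y} {x : D} (h : HasLocalDisc n A x) {α : D → Y}
    {β : Y → D}
    (hα : ContMDiffAt 𝓘(ℂ, EuclideanSpace ℂ (Fin n)) 𝓘(ℂ, EuclideanSpace ℂ (Fin n)) ω α x)
    (hβ : ContMDiffAt 𝓘(ℂ, EuclideanSpace ℂ (Fin n)) 𝓘(ℂ, EuclideanSpace ℂ (Fin n)) ω β (α x))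
    (hβα : ∀ᶠ q in 𝓝 x, β (α q) = q) (hαβ : ∀ᶠ q in 𝓝 (α x), α (β q) = q)
    (hAB : ∀ᶠ q in 𝓝 x, q ∈ A → α q ∈ B) : HasLocalDisc n B (α x) := by
  obtain ⟨F, G, v, hF, hG, hGF, hFG, hv, hA⟩ := h
  have hx : β (α x) = x := hβα.self_of_nhds
  have hGx : G (F x) = x := hGF.self_of_nhds
  have hβt : Tendsto β (𝓝 (α x)) (𝓝 x) := by
    have := hβ.continuousAt.tendsto
    rwa [hx] at this
  have hGt : Tendsto G (𝓝 (F x)) (𝓝 x) := by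
    have := hG.continuousAt.tendsto
    rwa [hGx] at this
  refine ⟨F ∘ β, α ∘ G, v, ?_, ?_, ?_, ?_, hv, ?_⟩
  · exact ContMDiffAt.comp (α x) (by rwa [hx]) hβ
  · rw [Function.comp_apply, hx]
    exact ContMDiffAt.comp (F x) (by rwa [hGx]) hG
  · filter_upwards [hβt.eventually hGF, hαβ] with q h1 h2
    simp only [Function.comp_apply, h1, h2]
  · rw [Function.comp_apply, hx]
    filter_upwards [hGt.eventually hβα, hFG] with q h1 h2
    simp only [Function.comp_apply, h1, h2]
  · simp only [Function.comp_apply, hx]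
    have hline : Tendsto (fun ζ : ℂ => F x + ζ • v) (𝓝 0) (𝓝 (F x)) := by
      have : Continuous fun ζ : ℂ => F x + ζ • v := by fun_prop
      simpa using this.tendsto 0
    filter_upwards [hA, (hGt.comp hline).eventually hAB] with ζ h1 h2 using h2 h1

theorem IsRegularPointOfDim.hasLocalDisc [IsManifold 𝓘(ℂ, EuclideanSpace ℂ (Fin n)) ω Y]
    {A : Set Y} {k : ℕ} {y : Y} (hk : 0 < k) (h : IsRegularPointOfDim n A k y) :
    HasLocalDisc n A y := by
  obtain ⟨hyA, e, he, hye, S, hS, hSA⟩ := h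
  have : S ≠ ⊥ := by
    rintro rfl
    simp at hS
    omega
  obtain ⟨v, hvS, hv⟩ := S.exists_mem_ne_zero_of_ne_bot this
  refine ⟨e, e.symm, v, contMDiffAt_of_mem_maximalAtlas he hye,
    contMDiffAt_symm_of_mem_maximalAtlas he (e.map_source hye), ?_, ?_, hv, ?_⟩
  · exact e.eventually_left_inverse hye
  · exact e.eventually_right_inverse (e.map_source hye)
  · have hline : Tendsto (fun ζ : ℂ => e y + ζ • v) (𝓝 0) (𝓝 (e y)) := by
      have : Continuous fun ζ : ℂ => e y + ζ • v := by fun_prop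
      simpa using this.tendsto 0
    filter_upwards [hline.eventually (e.open_target.mem_nhds (e.map_source hye))] with ζ hζ
    rw [hSA _ (e.map_target hζ), e.right_inv hζ]
    exact S.add_mem ((hSA y hye).mp hyA) (S.smul_mem ζ hvS)

theorem IsStrictlyPlurisubharmonic.upperSemicontinuous {φ : D → ℝ}
    (hφ : IsStrictlyPlurisubharmonic n φ) : UpperSemicontinuous φ := by
  intro x
  obtain ⟨e, -, hxe, V, hV, hxV, -, ε, -, hw⟩ := hφ x
  intro t ht
  have h1 := (hw.upperSemicontinuousAt hV hxV).add
    (Continuous.upperSemicontinuous (f := fun z : EuclideanSpace ℂ (Fin n) => ε * ‖z‖ ^ 2)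
      (by fun_prop) (e x))
  have h2 := h1 t (by simpa [e.left_inv hxe] using ht)
  filter_upwards [(e.continuousAt hxe).eventually h2, e.eventually_left_inverse hxe] with q h3 h4
  simpa [h4] using h3

/-- Over a neighbourhood of each point of the base, a strictly plurisubharmonic function stays
away from its upper bounds on the points through which `A` contains a disc. -/
theorem IsHolomorphicCovering.exists_eventually_le_sub
    [IsManifold 𝓘(ℂ, EuclideanSpace ℂ (Fin n)) ω D] {π : Y → D}
    (hπ : IsHolomorphicCovering n π) {φ : D → ℝ} (hφ : IsStrictlyPlurisubharmonic n φ)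
    {A : Set Y} (hA : IsAnalyticSubset n A) {M : ℝ}
    (hM : ∀ y, HasLocalDisc n A y → φ (π y) ≤ M) (x : D) :
    ∃ η > 0, ∀ᶠ x' in 𝓝 x, ∀ y, HasLocalDisc n A y → π y = x' → φ x' ≤ M - η := by
  obtain ⟨e, he, hxe, V, hV, hxV, hVe, ε, hε, hw⟩ := hφ x
  -- One `U` serves all sheets, so `r` and the gap do not depend on `y`. This is where a covering is
  -- needed rather than a local biholomorphism.
  obtain ⟨U, hU, hxU, hsec⟩ := (hπ.1 x).exists_section
  have hnhds : V ∩ e.symm ⁻¹' U ∈ 𝓝 (e x) := by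
    refine inter_mem (hV.mem_nhds hxV) ?_
    refine (e.symm.continuousAt (e.map_source hxe)).preimage_mem_nhds ?_
    rw [e.left_inv hxe]
    exact hU.mem_nhds hxU
  obtain ⟨r, hr, hball⟩ := Metric.nhds_basis_ball.mem_iff.mp hnhds
  -- On the half-radius ball, the bound M - (ε/2)r² for φ - (ε/2)|z - a|² leaves this gap for φ.
  refine ⟨ε / 2 * (r ^ 2 - (r / 2) ^ 2), mul_pos (by linarith) (by nlinarith), ?_⟩
  have hxball : ∀ᶠ x' in 𝓝 x, e x' ∈ ball (e x) (r / 2) :=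
    (e.continuousAt hxe).eventually (isOpen_ball.mem_nhds (mem_ball_self (half_pos hr)))
  filter_upwards [hxball, e.open_source.mem_nhds hxe, hU.mem_nhds hxU] with x' h1 h2 h3
  rintro y hyA rfl
  obtain ⟨s, hsc, hπs, hsy⟩ := hsec y h3
  have hinv : ∀ q ∈ ball (e x) r, π (s (e.symm q)) = e.symm q := fun q hq => hπs _ (hball hq).2
  have hte : ∀ q ∈ ball (e x) r, q ∈ e.target := fun q hq => hVe (hball hq).1
  have hright : ∀ q ∈ ball (e x) r, e (π (s (e.symm q))) = q := fun q hq => by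
    rw [hinv q hq, e.right_inv (hte q hq)]
  have hrightev : ∀ q ∈ ball (e x) r, ∀ᶠ q' in 𝓝 q, e (π (s (e.symm q'))) = q' := fun q hq => by
    filter_upwards [isOpen_ball.mem_nhds hq] with q' hq' using hright q' hq'
  have hloc : ∀ q ∈ ball (e x) r, _ := fun q hq =>
    IsLocalDiffeomorphAt.contMDiffAt_section hU hsc hπs (hball hq).2 (hπ.2 (s (e.symm q)))
  have hσ : ∀ q ∈ ball (e x) r, ContMDiffAt 𝓘(ℂ, EuclideanSpace ℂ (Fin n))
      𝓘(ℂ, EuclideanSpace ℂ (Fin n)) ω (fun q => s (e.symm q)) q := fun q hq =>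
    ContMDiffAt.comp q (hloc q hq).1 (contMDiffAt_symm_of_mem_maximalAtlas he (hte q hq))
  have hτ : ∀ q ∈ ball (e x) r, ContMDiffAt 𝓘(ℂ, EuclideanSpace ℂ (Fin n))
      𝓘(ℂ, EuclideanSpace ℂ (Fin n)) ω (fun y => e (π y)) (s (e.symm q)) := fun q hq => by
    refine ContMDiffAt.comp (s (e.symm q)) ?_ (hπ.2 (s (e.symm q))).contMDiffAt
    rw [hinv q hq]
    exact contMDiffAt_of_mem_maximalAtlas he (e.map_target (hte q hq))
  have hleft : ∀ q ∈ ball (e x) r, ∀ᶠ y' in 𝓝 (s (e.symm q)), s (e.symm (e (π y'))) = y' := by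
    intro q hq
    have hπt : Tendsto π (𝓝 (s (e.symm q))) (𝓝 (e.symm q)) := by
      have := (hπ.2 (s (e.symm q))).contMDiffAt.continuousAt.tendsto
      rwa [hinv q hq] at this
    filter_upwards [(hloc q hq).2,
      hπt.eventually (e.open_source.mem_nhds (e.map_target (hte q hq)))] with y' a1 a2
    rw [e.left_inv a2, a1]
  set A' : Set (EuclideanSpace ℂ (Fin n)) := (fun q => s (e.symm q)) ⁻¹' A with hA'
  have hyb : e (π y) ∈ ball (e x) r := ball_subset_ball (by linarith) h1
  have hσy : s (e.symm (e (π y))) = y := by rw [e.left_inv h2, hsy]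
  have hyA' : HasLocalDisc n A' (e (π y)) := by
    have b1 := hτ _ hyb
    have b2 := hσ _ hyb
    have b3 := hleft _ hyb
    have b4 := hrightev _ hyb
    rw [hσy] at b1 b3
    refine hyA.map (α := fun y => e (π y)) b1 b2 b3 b4 ?_
    filter_upwards [b3] with y' hy' hy'A
    change s (e.symm (e (π y'))) ∈ A
    rwa [hy']
  have hσc : ContinuousOn (fun q => s (e.symm q)) (ball (e x) r) := fun q hq =>
    (hσ q hq).continuousAt.continuousWithinAt
  -- Taking `Q` to be `ε ‖z‖²` turns the plurisubharmonic function back into `φ` and supplies growth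
  -- `ε`.
  have key := (hw.mono (W := ball (e x) r) fun q hq => (hball hq).1).le_of_hasLocalDisc_of_locally
    ((circleGrowth_norm_sub_sq (0 : EuclideanSpace ℂ (Fin n))).const_mul ε) (by linarith)
    (A := A') (M := M)
    (by
      intro p hp
      obtain ⟨W, hW, hpW, m, f, hf, hfA⟩ := hA (s (e.symm p))
      refine ⟨ball (e x) r ∩ (fun q => s (e.symm q)) ⁻¹' W, hσc.isOpen_inter_preimage isOpen_ball hW,
        ⟨hp, hpW⟩, m, fun i q => f i (s (e.symm q)), fun i q hq => ?_, fun q hq => hfA _ hq.2⟩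
      rw [← contMDiffAt_omega_iff_analyticAt]
      exact ContMDiffAt.comp q ((hf i).contMDiffAt (hW.mem_nhds hq.2)) (hσ q hq.1))
    (by
      intro q hq hqA
      have := hM _ (hqA.map (α := fun q => s (e.symm q)) (B := A) (hσ q hq) (hτ q hq)
        (hrightev q hq) (hleft q hq) (Eventually.of_forall fun q' hq' => hq'))
      simp only [hinv q hq] at this
      simpa using this)
    hyb hyA'
  have hn : ‖e (π y) - e x‖ ^ 2 ≤ (r / 2) ^ 2 := by
    rw [mem_ball_iff_norm] at h1
    gcongr
  have hn' := mul_le_mul_of_nonneg_left hn (half_pos hε).le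
  simp only [e.left_inv h2, sub_zero, mul_one] at key
  linarith

end Coverings

/-! ### Conclusion by compactness of `K`. -/

theorem lemma1 (n : ℕ)
    {D : Type*} [TopologicalSpace D] [T2Space D] [ChartedSpace (EuclideanSpace ℂ (Fin n)) D]
    [IsManifold 𝓘(ℂ, EuclideanSpace ℂ (Fin n)) ω D]
    {Y : Type*} [TopologicalSpace Y] [ChartedSpace (EuclideanSpace ℂ (Fin n)) Y]
    [IsManifold 𝓘(ℂ, EuclideanSpace ℂ (Fin n)) ω Y]
    (π : Y → D) (hπ : IsHolomorphicCovering n π)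
    (φ : D → ℝ) (hφ : IsStrictlyPlurisubharmonic n φ)
    (A : Set Y) (hA : IsAnalyticSubset n A) (hdim : 0 < analyticDim n A) :
    ∀ K : Set D, IsCompact K → ¬ (π '' A ⊆ K) := by
  intro K hK hAK
  obtain ⟨y₀, hy₀⟩ : ∃ y, HasLocalDisc n A y := by
    obtain ⟨k, hk⟩ := lt_iSup_iff.mp hdim
    obtain ⟨⟨y, hy⟩, hk⟩ := lt_iSup_iff.mp hk
    exact ⟨y, hy.hasLocalDisc (by exact_mod_cast hk)⟩
  have hSK : ∀ y, HasLocalDisc n A y → π y ∈ K := fun y hy => hAK (mem_image_of_mem π hy.mem)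
  obtain ⟨B, hB⟩ := (hφ.upperSemicontinuous.upperSemicontinuousOn K).bddAbove_of_isCompact hK
  set T : Set ℝ := (fun y => φ (π y)) '' {y | HasLocalDisc n A y} with hT
  have hbdd : BddAbove T := by
    refine ⟨B, ?_⟩
    rintro _ ⟨y, hy, rfl⟩
    exact hB (mem_image_of_mem φ (hSK y hy))
  have hM : ∀ y, HasLocalDisc n A y → φ (π y) ≤ sSup T := fun y hy =>
    le_csSup hbdd (mem_image_of_mem _ hy)
  obtain ⟨η, hη, hle⟩ := hK.exists_pos_forall
    (P := fun x η => ∀ y, HasLocalDisc n A y → π y = x → φ x ≤ sSup T - η)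
    (fun x η η' _ h h1 y hy hyx => (h1 y hy hyx).trans (by linarith))
    (fun x _ => hπ.exists_eventually_le_sub hφ hA hM x)
  have : sSup T ≤ sSup T - η := by
    refine csSup_le ⟨_, mem_image_of_mem _ hy₀⟩ ?_
    rintro _ ⟨y, hy, rfl⟩
    exact hle _ (hSK y hy) y hy rfl
  linarith
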